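/- Let $1\le p<\infty$, $\beta\in\mathbb R$, and let $\psi:[1,\infty)\to\mathbb R$ belong to $\mathfrak M$, the set of positive, continuous, convex functions on $[1,\infty)$ tending to $0$ at infinity. For $h\in\mathfrak M$ and $t\ge1$ put $\alpha(h;t)=\dfrac{h(t)}{t\,|h'(t+0)|}$, where $h'(t+0)$ is the right derivative, and let $\mathfrak M_C$ be the set of $h\in\mathfrak M$ for which there are $K_1,K_2>0$ with $K_1\le\alpha(h;t)\le K_2$ for all $t\ge1$. Put $g_\delta(t)=\psi(t)t^{\delta}$. A non-negative sequence $(a_k)_{k\ge1}$ is in $GM^+$ if there is $A\ge1$ such that $a_{n_1}+\sum_{k=n_1}^{m-1}|a_k-a_{k+1}|\le A\,a_m$ for all natural $n_1\le m$; it is in $GA^+$ if for some $\varepsilon>0$ there is a constant $K$ with $a_{n_1}n_1^{-\varepsilon}\le K a_{n_2}n_2^{-\varepsilon}$ for all natural $n_1\le n_2$. Let $a_k(f),b_k(f)$ be the Fourier coefficients of a $2\pi$-periodic summable $f$, so that its Fourier series is $\frac{a_0(f)}2+\sum_{k\ge1}(a_k(f)\cos kx+b_k(f)\sin kx)$. Let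 $C^\psi_{\beta,p}$ be the class of continuous $2\pi$-periodic real functions $f$ for which $$\sum_{k=1}^\infty\frac1{\psi(k)}\Big(a_k(f)\cos\big(kx+\tfrac{\beta\pi}2\big)+b_k(f)\sin\big(kx+\tfrac{\beta\pi}2\big)\Big)$$ is the Fourier series of a $2\pi$-periodic summable function $\varphi$ with $\int_0^{2\pi}|\varphi(t)|^p\,dt\le1$. For $n\in\mathbb N=\{1,2,\dots\}$ let $$\sigma_{n-1}(f;x)=\frac{a_0(f)}2+\sum_{k=1}^{n-1}\Big(1-\frac kn\Big)\big(a_k(f)\cos kx+b_k(f)\sin kx\big)$$ be the Fejér sum, and, with $\|\cdot\|_C$ the uniform norm, $$\mathcal E(C^\psi_{\beta,p};\sigma_{n-1})_C=\sup_{f\in C^\psi_{\beta,p}}\|f-\sigma_{n-1}(f)\|_C,\qquad E_n(C^\psi_{\beta,p})_C=\sup_{f\in C^\psi_{\beta,p}}\ \inf_{t_{n-1}}\|f-t_{n-1}\|_C,$$ where $t_{n-1}$ runs over the real trigonometric polynomials of order at most $n-1$. Write $A(n)\asymp B(n)$ if there is a constant $K>0$, independent of $n$, with $A(n)\le K B(n)$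 and $B(n)\le K A(n)$ for all $n\in\mathbb N$. Assume that $g_{1/p}\in\mathfrak M_C$ and that the sequence $(g_{1+1/p}(k))_{k\ge1}$ belongs to $GM^+\cap GA^+$. (i) If $1<p<\infty$, $\frac1p+\frac1{p'}=1$, $\sum_{k=1}^\infty\psi^{p'}(k)k^{p'-2}<\infty$ and $\inf_{t\ge1}\alpha(g_{1/p};t)>\frac{p'}2$, then $$E_n(C^\psi_{\beta,p})_C\asymp\mathcal E(C^\psi_{\beta,p};\sigma_{n-1})_C\asymp\psi(n)n^{1/p}.$$ (ii) If $p=1$, $\sum_{k=1}^\infty\psi(k)<\infty$ and $\inf_{t\ge1}\alpha(g_1;t)>1$, then $$E_n(C^\psi_{\beta,1})_C\asymp\mathcal E(C^\psi_{\beta,1};\sigma_{n-1})_C\asymp\psi(n)n.$$ -/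

import Mathlib

open Real Set Filter Topology MeasureTheory
open scoped ENNReal

noncomputable section

namespace PsiBeta

/-- The cosine Fourier coefficient `a_k(f) = (1/π) ∫_0^{2π} f(t) cos kt dt`. -/
def fourierA (f : ℝ → ℝ) (k : ℕ) : ℝ :=
  (1 / π) * ∫ t in (0 : ℝ)..(2 * π), f t * Real.cos (k * t)

/-- The sine Fourier coefficient `b_k(f) = (1/π) ∫_0^{2π} f(t) sin kt dt`. -/
def fourierB (f : ℝ → ℝ) (k : ℕ) : ℝ :=
  (1 / π) * ∫ t in (0 : ℝ)..(2 * π), f t * Real.sin (k * t)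

/-- Lebesgue measure on one period; the norms of `L_p` are taken with respect to it
(without normalization). -/
def periodMeasure : Measure ℝ := volume.restrict (Ioc 0 (2 * π))

/-- `f` belongs to `L_1`: it is `2π`-periodic and summable over a period. -/
def IsPeriodicSummable (f : ℝ → ℝ) : Prop :=
  Function.Periodic f (2 * π) ∧ Integrable f periodMeasure

/-- The trigonometric series `A 0 / 2 + ∑_{k ≥ 1} (A k cos kx + B k sin kx)` is the Fourier
series of `φ ∈ L_1`. -/
def IsFourierSeriesOf (A B : ℕ → ℝ) (φ : ℝ → ℝ) : Prop :=
  IsPeriodicSummable φ ∧ (∀ k, fourierA φ k = A k) ∧ ∀ k, 1 ≤ k → fourierB φ k = B k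

/-- `φ` is the `(ψ, β)`-derivative of `f`: both are in `L_1` and the series
`∑_{k ≥ 1} (1 / ψ k) (a_k(f) cos (kx + βπ/2) + b_k(f) sin (kx + βπ/2))`
is the Fourier series of `φ` (the `k`-th term is expanded by the addition formulas; there is
no constant term). -/
def IsPsiBetaDeriv (ψ : ℝ → ℝ) (β : ℝ) (f φ : ℝ → ℝ) : Prop :=
  IsPeriodicSummable f ∧
  IsFourierSeriesOf
    (fun k => if k = 0 then 0 else
      (1 / ψ k) * (fourierA f k * Real.cos (β * π / 2) + fourierB f k * Real.sin (β * π / 2)))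
    (fun k =>
      (1 / ψ k) * (fourierB f k * Real.cos (β * π / 2) - fourierA f k * Real.sin (β * π / 2)))
    φ

/-- The class `C^ψ_{β,p}`: continuous `2π`-periodic functions which have a
`(ψ, β)`-derivative in the unit ball of `L_p`. -/
def classC (ψ : ℝ → ℝ) (β p : ℝ) : Set (ℝ → ℝ) :=
  {f | Continuous f ∧ Function.Periodic f (2 * π) ∧
    ∃ φ : ℝ → ℝ, IsPsiBetaDeriv ψ β f φ ∧ MemLp φ (ENNReal.ofReal p) periodMeasure ∧
      eLpNorm φ (ENNReal.ofReal p) periodMeasure ≤ 1}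

/-- The uniform norm, with values in `[0, ∞]`. -/
def normC (f : ℝ → ℝ) : ℝ≥0∞ := ⨆ x : ℝ, ‖f x‖ₑ

/-- Real trigonometric polynomials of order at most `n - 1` (for `n ≥ 1`). -/
def trigPolys (n : ℕ) : Set (ℝ → ℝ) :=
  {t | ∃ c d : ℕ → ℝ, ∀ x,
    t x = c 0 / 2 + ∑ k ∈ Finset.Ico 1 n, (c k * Real.cos (k * x) + d k * Real.sin (k * x))}

/-- The Fejér sum `σ_{n-1}(f)` of order `n - 1` (for `n ≥ 1`). -/
def fejerSum (n : ℕ) (f : ℝ → ℝ) (x : ℝ) : ℝ :=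
  fourierA f 0 / 2 + ∑ k ∈ Finset.Ico 1 n, (1 - (k : ℝ) / n) *
    (fourierA f k * Real.cos (k * x) + fourierB f k * Real.sin (k * x))

/-- `E_n(C^ψ_{β,p})_C`: best uniform approximation of the class by trigonometric polynomials
of order at most `n - 1`. -/
def bestApprox (ψ : ℝ → ℝ) (β p : ℝ) (n : ℕ) : ℝ≥0∞ :=
  ⨆ f ∈ classC ψ β p, ⨅ t ∈ trigPolys n, normC (fun x => f x - t x)

/-- `𝓔(C^ψ_{β,p}; σ_{n-1})_C`: the exact upper bound of the uniform deviations of the Fejér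
sums on the class. -/
def fejerDeviation (ψ : ℝ → ℝ) (β p : ℝ) (n : ℕ) : ℝ≥0∞ :=
  ⨆ f ∈ classC ψ β p, normC (fun x => f x - fejerSum n f x)

/-- The set `𝔐` of positive continuous convex functions on `[1, ∞)` that tend to zero
at infinity. -/
def setM : Set (ℝ → ℝ) :=
  {ψ | (∀ t, 1 ≤ t → 0 < ψ t) ∧ ContinuousOn ψ (Ici 1) ∧ ConvexOn ℝ (Ici 1) ψ ∧
    Tendsto ψ atTop (𝓝 0)}

/-- The characteristic `α(ψ; t) = ψ(t) / (t |ψ'(t + 0)|)`, with the right derivative of `ψ`. -/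
def alpha (ψ : ℝ → ℝ) (t : ℝ) : ℝ := ψ t / (t * |derivWithin ψ (Ioi t) t|)

/-- The set `𝔐_C` of those `ψ ∈ 𝔐` for which `α(ψ; ·)` lies between two positive constants
on `[1, ∞)`. -/
def setMC : Set (ℝ → ℝ) :=
  {ψ | ψ ∈ setM ∧ ∃ K₁ K₂ : ℝ, 0 < K₁ ∧ 0 < K₂ ∧
    ∀ t, 1 ≤ t → K₁ ≤ alpha ψ t ∧ alpha ψ t ≤ K₂}

/-- `g_δ(t) = ψ(t) t^δ`. -/
def gFun (ψ : ℝ → ℝ) (δ t : ℝ) : ℝ := ψ t * t ^ δ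

/-- Generally monotonically increasing sequences `(a_k)_{k ≥ 1}`: the class `GM⁺`. -/
def IsGM (a : ℕ → ℝ) : Prop :=
  (∀ k, 1 ≤ k → 0 ≤ a k) ∧ ∃ A : ℝ, 1 ≤ A ∧ ∀ n₁ n₂ : ℕ, 1 ≤ n₁ → n₁ ≤ n₂ →
    ∀ m ∈ Finset.Icc n₁ n₂, a n₁ + ∑ k ∈ Finset.Ico n₁ m, |a k - a (k + 1)| ≤ A * a m

/-- Almost increasing (according to Bernstein) sequences `(a_k)_{k ≥ 1}`. -/
def IsAlmostIncreasing (a : ℕ → ℝ) : Prop :=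
  (∀ k, 1 ≤ k → 0 ≤ a k) ∧ ∃ K : ℝ, ∀ n₁ n₂ : ℕ, 1 ≤ n₁ → n₁ ≤ n₂ → a n₁ ≤ K * a n₂

/-- The class `GA⁺`: for some `ε > 0` the sequence `a_k k^{-ε}` almost increases. -/
def IsGA (a : ℕ → ℝ) : Prop :=
  ∃ ε : ℝ, 0 < ε ∧ IsAlmostIncreasing (fun k => a k * (k : ℝ) ^ (-ε))

/-- `A(n) = O(B(n))`, `n ≥ 1`: there is a finite constant `K > 0`, independent of `n`, with
`A(n) ≤ K B(n)` for every natural `n ≥ 1`. -/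
def BigO (A B : ℕ → ℝ≥0∞) : Prop :=
  ∃ K : ℝ, 0 < K ∧ ∀ n : ℕ, 1 ≤ n → A n ≤ ENNReal.ofReal K * B n

/-- `A(n) ≍ B(n)`. -/
def OrderEq (A B : ℕ → ℝ≥0∞) : Prop := BigO A B ∧ BigO B A

end PsiBeta

end

/-! The hypotheses trap `ψ` between powers. `GA⁺` makes `ψ(k) k^a` almost increasing for some `1 < a
< 1 + 1/p`. The upper bound on `α(g_{1/p}; ·)` makes `ψ(k) k^b` decreasing for some `b > 1/p`, with
`b < 1` when `p > 1`. Convexity of `ψ` bounds the increments of `k ψ(k)` by a multiple of `ψ(k)`.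
`PowerRegular` records this, and the estimates below use nothing else about `ψ`.

Upper bound: by Fejér's theorem `f - σ_{n-1}(f)` is the limit in `N` of `σ_{N-1}(f) - σ_{n-1}(f)`,
which is the convolution of the `(ψ, β)`-derivative `φ` with a trigonometric polynomial, so only
bounds uniform in `N` are needed. Splitting frequencies at `1/t`, with absolute values below and
summation by parts above, bounds this kernel by a multiple of `ψ(n) n^(a-1) t^(a-2)` for `t ≥ 1/n`
and of `ψ(n) n^b t^(b-1)` for `t < 1/n`. Since `b > 1/p` and `a < 1 + 1/p`, its `L_q` norm with
conjugate `q` is `O(ψ(n) n^(1/p))`, and Hölder's inequality finishes the case `p > 1`. For `p = 1`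
one has `b > 1`, and summing absolute values bounds the kernel uniformly by a multiple of `ψ(n) n`
(`exists_abs_sub_fejerSum_le`).

Lower bound: take for `φ` a multiple of the Fejér kernel of order `n` modulated to frequency `2n`.
The corresponding `f` has spectrum strictly between `n` and `3n`, where `ψ(k)` is at least a
constant times `ψ(n)`. Pairing `f - T` with the modulated kernel annihilates every polynomial `T` of
order below `n` (`exists_le_abs_sub`). As best approximation never exceeds the Fejér deviation, the
three quantities close into a cycle. -/

namespace PsiBeta

/-! ### Power regularity of `ψ`. -/

/-- A positive decreasing sequence which grows at least like `k ^ (-a)`, decays at least like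
`k ^ (-b)`, and for which the increments of `k u_k` are dominated by `u_k`. -/
structure PowerRegular (u : ℕ → ℝ) (a b C : ℝ) : Prop where
  one_le : 1 ≤ C
  pos : ∀ k, 1 ≤ k → 0 < u k
  anti : ∀ j k, 1 ≤ j → j ≤ k → u k ≤ u j
  incr : ∀ j k : ℕ, 1 ≤ j → j ≤ k → u j * (j : ℝ) ^ a ≤ C * (u k * (k : ℝ) ^ a)
  decr : ∀ j k : ℕ, 1 ≤ j → j ≤ k → u k * (k : ℝ) ^ b ≤ u j * (j : ℝ) ^ b
  var : ∀ k : ℕ, 1 ≤ k → |((k : ℝ) + 1) * u (k + 1) - k * u k| ≤ C * u k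

theorem derivWithin_nonpos_of_mem_setM {g : ℝ → ℝ} (hg : g ∈ setM) {t : ℝ} (ht : 1 < t) :
    derivWithin g (Ioi t) t ≤ 0 := by
  obtain ⟨hpos, -, hconv, hlim⟩ := hg
  by_contra! h
  obtain ⟨y, hy1, hy2⟩ := ((hlim.eventually (gt_mem_nhds (hpos t ht.le))).and
    (eventually_gt_atTop t)).exists
  have hs := hconv.rightDeriv_le_slope_of_mem_interior (x := t) (y := y)
    (by rw [interior_Ici]; exact ht) (ht.le.trans hy2.le) hy2
  rw [slope_def_field] at hs
  have : (g y - g t) / (y - t) < 0 := div_neg_of_neg_of_pos (by linarith) (by linarith)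
  linarith

theorem slope_le_derivWithin {g : ℝ → ℝ} (hg : ConvexOn ℝ (Ici 1) g) {s t : ℝ}
    (hs : 1 ≤ s) (hst : s < t) : (g t - g s) / (t - s) ≤ derivWithin g (Ioi t) t := by
  have hti : t ∈ interior (Ici (1 : ℝ)) := by rw [interior_Ici]; exact hs.trans_lt hst
  have h := hg.hasDerivWithinAt_rightDeriv_of_mem_interior hti
  have h2 := (hasDerivWithinAt_iff_tendsto_slope' self_notMem_Ioi).mp h
  refine ge_of_tendsto h2 ?_
  filter_upwards [self_mem_nhdsWithin] with y hy
  rw [slope_def_field]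
  exact hg.slope_mono_adjacent hs ((hs.trans hst.le).trans (le_of_lt hy)) hst hy

/-- The bound `α ≤ K₂` says `g'/g ≤ -1/(K₂ t)`, so `g` decays at least like a power. Convexity turns
this into a bound on `g(k) - g(k+1)`, and Bernoulli's inequality compares it with `(1 + 1/k)^δ`;
replacing `1/k` by `2/(k+1)` costs the factor 2 in `δ₀`. Every smaller `δ` is allowed so that the
final exponent can be kept below 1. -/
theorem exists_rpow_mul_antitone {g : ℝ → ℝ} (hg : g ∈ setMC) :
    ∃ δ₀ : ℝ, 0 < δ₀ ∧ ∀ δ, 0 < δ → δ ≤ δ₀ → ∀ j k : ℕ, 1 ≤ j → j ≤ k →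
      g k * (k : ℝ) ^ δ ≤ g j * (j : ℝ) ^ δ := by
  obtain ⟨hM, K₁, K₂, hK₁, hK₂, hα⟩ := hg
  refine ⟨min 1 (1 / (2 * K₂)), by positivity, fun δ hδ hδ' j k hj hjk => ?_⟩
  have hδ1 : δ ≤ 1 := hδ'.trans (min_le_left _ _)
  have hδ2 : 2 * δ ≤ 1 / K₂ := by
    have := hδ'.trans (min_le_right _ _)
    calc 2 * δ ≤ 2 * (1 / (2 * K₂)) := by linarith
      _ = 1 / K₂ := by field_simp
  induction k, hjk using Nat.le_induction with
  | base => exact le_rfl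
  | succ k hk ih =>
    refine le_trans ?_ ih
    have hk1 : (1 : ℝ) ≤ k := by exact_mod_cast hj.trans hk
    have hk0 : (0 : ℝ) < k := by linarith
    push_cast
    have ht : (1 : ℝ) < k + 1 := by linarith
    have hd := derivWithin_nonpos_of_mem_setM hM ht
    have hs := slope_le_derivWithin hM.2.2.1 hk1 (show (k : ℝ) < k + 1 by linarith)
    obtain ⟨h1, h2⟩ := hα _ ht.le
    have hgp := hM.1 _ ht.le
    set d := derivWithin g (Ioi ((k : ℝ) + 1)) (k + 1) with hdd
    unfold alpha at h1 h2
    rw [← hdd, abs_of_nonpos hd] at h1 h2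
    -- If the derivative vanished, the quotient `α` would take the value 0 by the convention for
    -- division, against `K₁ > 0`.
    have hd0 : d ≠ 0 := by
      intro h0
      rw [h0] at h1
      simp at h1
      linarith
    have hdneg : 0 < -d := by
      have := lt_of_le_of_ne hd hd0
      linarith
    rw [div_le_iff₀ (by positivity)] at h2
    have hstep : g (k + 1) * (1 + 1 / (K₂ * (k + 1))) ≤ g k := by
      have e : (k : ℝ) + 1 - k = 1 := by ring
      rw [e, div_one] at hs
      have : g (k + 1) / (K₂ * (k + 1)) ≤ -d := by
        rw [div_le_iff₀ (by positivity)]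
        linarith
      calc g (k + 1) * (1 + 1 / (K₂ * (k + 1))) = g (k + 1) + g (k + 1) / (K₂ * (k + 1)) := by ring
        _ ≤ g k := by linarith
    have hb : (1 + 1 / (k : ℝ)) ^ δ ≤ 1 + 1 / (K₂ * (k + 1)) := by
      have h0 : (0 : ℝ) ≤ 1 / k := by positivity
      refine (rpow_one_add_le_one_add_mul_self (by linarith) hδ.le hδ1).trans ?_
      have : δ * (1 / k) ≤ 2 * δ * (1 / (k + 1)) := by
        rw [mul_one_div, mul_one_div, div_le_div_iff₀ hk0 (by linarith)]
        nlinarith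
      have h3 : 2 * δ * (1 / ((k : ℝ) + 1)) ≤ 1 / K₂ * (1 / (k + 1)) := by gcongr
      have h4 : 1 / (K₂ * ((k : ℝ) + 1)) = 1 / K₂ * (1 / (k + 1)) := by field_simp
      linarith
    have he : ((k : ℝ) + 1) ^ δ = (k : ℝ) ^ δ * (1 + 1 / (k : ℝ)) ^ δ := by
      rw [← Real.mul_rpow hk0.le (by positivity)]
      congr 1
      field_simp
    rw [he]
    calc g (k + 1) * ((k : ℝ) ^ δ * (1 + 1 / (k : ℝ)) ^ δ)
        = (g (k + 1) * (1 + 1 / (k : ℝ)) ^ δ) * (k : ℝ) ^ δ := by ring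
      _ ≤ g k * (k : ℝ) ^ δ := by
        gcongr
        exact (mul_le_mul_of_nonneg_left hb hgp.le).trans hstep

theorem exists_rpow_almost_increasing {ψ : ℝ → ℝ} {p : ℝ} (hp : 1 ≤ p)
    (hpos : ∀ k : ℕ, 1 ≤ k → 0 < ψ k)
    (hGA : IsGA (fun k : ℕ => gFun ψ (1 + 1 / p) k)) :
    ∃ a C : ℝ, 1 < a ∧ a < 1 + 1 / p ∧ 1 ≤ C ∧ ∀ j k : ℕ, 1 ≤ j → j ≤ k →
      ψ j * (j : ℝ) ^ a ≤ C * (ψ k * (k : ℝ) ^ a) := by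
  obtain ⟨ε, hε, -, K, hK⟩ := hGA
  have hp0 : 0 < p := by linarith
  -- Lowering `ε` is harmless, because it multiplies by an increasing power; keeping it below `1/p`
  -- ensures that the exponent `1 + 1/p - η` exceeds 1.
  set η := min ε (1 / (2 * p)) with hη
  have hη0 : 0 < η := by positivity
  have hη1 : η < 1 / p := (min_le_right _ _).trans_lt (by
    rw [div_lt_div_iff₀ (by positivity) hp0]; linarith)
  have hηε : η ≤ ε := min_le_left _ _
  refine ⟨1 + 1 / p - η, max K 1, by linarith, by linarith, le_max_right _ _,
    fun j k hj hjk => ?_⟩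
  have h := hK j k hj hjk
  have hj0 : (0 : ℝ) < j := by exact_mod_cast hj
  have hk0 : (0 : ℝ) < k := by exact_mod_cast hj.trans hjk
  have hjk' : (j : ℝ) ≤ k := by exact_mod_cast hjk
  simp only [gFun] at h
  rw [mul_assoc, mul_assoc, ← Real.rpow_add hj0, ← Real.rpow_add hk0] at h
  have e : ∀ x : ℝ, 0 < x → x ^ (1 + 1 / p - η) = x ^ (1 + 1 / p + -ε) * x ^ (ε - η) := by
    intro x hx
    rw [← Real.rpow_add hx]
    congr 1
    ring
  rw [e _ hj0, e _ hk0, ← mul_assoc, ← mul_assoc, ← mul_assoc]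
  have hψk := hpos k (hj.trans hjk)
  have hψj := hpos j hj
  refine mul_le_mul (h.trans ?_) (Real.rpow_le_rpow hj0.le hjk' (by linarith)) (by positivity)
    (by positivity)
  rw [mul_assoc]
  gcongr
  exact le_max_left _ _

theorem exists_powerRegular {ψ : ℝ → ℝ} {p : ℝ} (hp : 1 ≤ p) (hψ : ψ ∈ setM)
    (hg : gFun ψ (1 / p) ∈ setMC) (hGA : IsGA (fun k : ℕ => gFun ψ (1 + 1 / p) k)) :
    ∃ a b C : ℝ, 1 < a ∧ a < 1 + 1 / p ∧ 1 / p < b ∧ (1 < p → b < 1) ∧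
      PowerRegular (fun k : ℕ => ψ k) a b C := by
  have hp0 : 0 < p := by linarith
  have hpos : ∀ k : ℕ, 1 ≤ k → 0 < ψ k := fun k hk => hψ.1 k (by exact_mod_cast hk)
  obtain ⟨a, C, ha1, ha2, hC, hinc⟩ := exists_rpow_almost_increasing hp hpos hGA
  obtain ⟨δ₀, hδ₀, hdec⟩ := exists_rpow_mul_antitone hg
  obtain ⟨δ, hδ, hδδ, hδp⟩ : ∃ δ, 0 < δ ∧ δ ≤ δ₀ ∧ (1 < p → 1 / p + δ < 1) := by
    rcases eq_or_lt_of_le hp with h | h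
    · exact ⟨δ₀, hδ₀, le_rfl, fun h' => absurd h' (by linarith)⟩
    · have : 1 / p < 1 := by rw [div_lt_one hp0]; exact h
      refine ⟨min δ₀ ((1 - 1 / p) / 2), ?_, min_le_left _ _, fun _ => ?_⟩
      · exact lt_min hδ₀ (by linarith)
      · have := min_le_right δ₀ ((1 - 1 / p) / 2)
        linarith
  have hdecr : ∀ j k : ℕ, 1 ≤ j → j ≤ k →
      ψ k * (k : ℝ) ^ (1 / p + δ) ≤ ψ j * (j : ℝ) ^ (1 / p + δ) := by
    intro j k hj hjk
    have hj0 : (0 : ℝ) < j := by exact_mod_cast hj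
    have hk0 : (0 : ℝ) < k := by exact_mod_cast hj.trans hjk
    have h := hdec δ hδ hδδ j k hj hjk
    simp only [gFun] at h
    rwa [Real.rpow_add hj0, Real.rpow_add hk0, ← mul_assoc, ← mul_assoc]
  have hanti : ∀ j k : ℕ, 1 ≤ j → j ≤ k → ψ k ≤ ψ j := by
    intro j k hj hjk
    have hj0 : (0 : ℝ) < j := by exact_mod_cast hj
    have hjk' : (j : ℝ) ≤ k := by exact_mod_cast hjk
    have hk0 : (0 : ℝ) < k := by linarith
    have h := hdecr j k hj hjk
    have h2 : (j : ℝ) ^ (1 / p + δ) ≤ (k : ℝ) ^ (1 / p + δ) :=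
      Real.rpow_le_rpow hj0.le hjk' (by positivity)
    have h3 : 0 < (j : ℝ) ^ (1 / p + δ) := by positivity
    refine le_of_mul_le_mul_right ?_ h3
    exact (mul_le_mul_of_nonneg_left h2 (hpos k (hj.trans hjk)).le).trans h
  have hinv : 1 / p ≤ 1 := by rw [div_le_one hp0]; exact hp
  refine ⟨a, 1 / p + δ, 12 * C + 1, ha1, ha2, by linarith, hδp,
    ⟨by linarith, hpos, hanti, ?_, hdecr, ?_⟩⟩
  · intro j k hj hjk
    refine (hinc j k hj hjk).trans ?_
    have := (hpos k (hj.trans hjk)).le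
    have : 0 ≤ ψ k * (k : ℝ) ^ a := by positivity
    nlinarith
  · intro k hk
    have hk0 : (0 : ℝ) < k := by exact_mod_cast hk
    have hk1 : (1 : ℝ) ≤ k := by exact_mod_cast hk
    have h1 : ψ ((k : ℝ) + 1) ≤ ψ k := by
      have := hanti k (k + 1) hk (by omega)
      push_cast at this
      exact this
    have hp1 : 0 < ψ ((k : ℝ) + 1) := hψ.1 _ (by linarith)
    have hpk := hpos k hk
    -- By convexity the drop at `k` is at most the mean slope over `[j, k]` with `j = ⌈k/2⌉`. Here
    -- `k ≤ 3(k - j)`, and almost increase gives `ψ(j) ≤ 2^2 C ψ(k)`, hence the constant `3 · 4C`.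
    -- For `k = 1` there is no such `j`, and positivity of `ψ(2)` suffices.
    have hkey : k * (ψ k - ψ (k + 1)) ≤ 12 * C * ψ k := by
      rcases Nat.lt_or_ge 1 k with h2k | h2k
      · set j := (k + 1) / 2 with hj
        have hj1 : 1 ≤ j := by omega
        have hjk : j < k := by omega
        have hj3 : k ≤ 3 * (k - j) := by omega
        have hj2 : k ≤ 2 * j := by omega
        have hjk' : (j : ℝ) < k := by exact_mod_cast hjk
        have hj0 : (1 : ℝ) ≤ j := by exact_mod_cast hj1
        have hj2' : (k : ℝ) ≤ 2 * j := by exact_mod_cast hj2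
        have hj3' : (k : ℝ) ≤ 3 * (k - j) := by
          have : (k : ℝ) ≤ 3 * ((k - j : ℕ) : ℝ) := by exact_mod_cast hj3
          rwa [Nat.cast_sub hjk.le] at this
        have hs := hψ.2.2.1.slope_mono_adjacent (x := (j : ℝ)) (y := k) (z := k + 1) hj0
          (show (1 : ℝ) ≤ k + 1 by linarith) hjk' (by linarith)
        have e : (k : ℝ) + 1 - k = 1 := by ring
        rw [e, div_one, div_le_iff₀ (by linarith)] at hs
        have hpj := hpos j hj1
        have h5 : ψ j ≤ 4 * C * ψ k := by
          have h6 := hinc j k hj1 hjk.le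
          have h7 : (k : ℝ) ^ a ≤ 4 * (j : ℝ) ^ a := by
            calc (k : ℝ) ^ a ≤ (2 * j) ^ a := by gcongr
              _ = 2 ^ a * (j : ℝ) ^ a := by rw [Real.mul_rpow (by norm_num) (by linarith)]
              _ ≤ 2 ^ (2 : ℝ) * (j : ℝ) ^ a := by gcongr <;> linarith
              _ = 4 * (j : ℝ) ^ a := by norm_num
          have h8 : 0 < (j : ℝ) ^ a := by positivity
          refine le_of_mul_le_mul_right ?_ h8
          calc ψ j * (j : ℝ) ^ a ≤ C * (ψ k * (k : ℝ) ^ a) := h6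
            _ ≤ C * (ψ k * (4 * (j : ℝ) ^ a)) := by gcongr
            _ = 4 * C * ψ k * (j : ℝ) ^ a := by ring
        have h9 : 0 ≤ ψ k - ψ (k + 1) := by linarith
        nlinarith
      · have : (k : ℝ) = 1 := by exact_mod_cast (le_antisymm h2k hk)
        have h3 : k * (ψ k - ψ (k + 1)) ≤ ψ k := by
          rw [this] at hp1 ⊢
          linarith
        nlinarith
    push_cast
    have h9 : 0 ≤ ψ k - ψ (k + 1) := by linarith
    have e : ((k : ℝ) + 1) * ψ (k + 1) - k * ψ k = ψ (k + 1) - k * (ψ k - ψ (k + 1)) := by ring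
    rw [e, abs_le]
    constructor <;> nlinarith

theorem PowerRegular.doubling {u : ℕ → ℝ} {a b C : ℝ} (h : PowerRegular u a b C) (ha : 0 ≤ a)
    {j k : ℕ} (hj : 1 ≤ j) (hjk : j ≤ k) {c : ℝ} (hc : (k : ℝ) ≤ c * j) :
    u j ≤ C * c ^ a * u k := by
  have hj0 : (0 : ℝ) < j := by exact_mod_cast hj
  have hk0 : (0 : ℝ) < k := by exact_mod_cast hj.trans hjk
  have hc0 : 0 < c := by
    by_contra! h0
    nlinarith
  have h8 : 0 < (j : ℝ) ^ a := by positivity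
  have h1 := h.one_le
  have h2 := h.pos k (hj.trans hjk)
  refine le_of_mul_le_mul_right ?_ h8
  calc u j * (j : ℝ) ^ a ≤ C * (u k * (k : ℝ) ^ a) := h.incr j k hj hjk
    _ ≤ C * (u k * (c * j) ^ a) := by gcongr
    _ = C * c ^ a * u k * (j : ℝ) ^ a := by
      rw [Real.mul_rpow hc0.le hj0.le]
      ring

/-! ### Power sums and summation by parts. -/

theorem sum_rpow_neg_le {c : ℝ} (hc0 : 0 ≤ c) (hc1 : c < 1) (M : ℕ) :
    ∑ k ∈ Finset.Ico 1 (M + 1), (k : ℝ) ^ (-c) ≤ (M : ℝ) ^ (1 - c) / (1 - c) := by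
  have hc : 0 < 1 - c := by linarith
  induction M with
  | zero => simp [Real.zero_rpow hc.ne']
  | succ M ih =>
    rw [Finset.sum_Ico_succ_top (by omega)]
    have hM0 : (0 : ℝ) ≤ M := by positivity
    have hM1 : (0 : ℝ) < (M : ℝ) + 1 := by linarith
    rw [le_div_iff₀ hc] at ih ⊢
    push_cast
    have h := rpow_one_add_le_one_add_mul_self (s := -(1 / ((M : ℝ) + 1))) (by
      rw [neg_le_neg_iff, div_le_one hM1]; linarith) hc.le (by linarith : 1 - c ≤ 1)
    have e : 1 + -(1 / ((M : ℝ) + 1)) = M / (M + 1) := by field_simp; ring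
    rw [e, Real.div_rpow hM0 hM1.le, div_le_iff₀ (by positivity)] at h
    have e2 : ((M : ℝ) + 1) ^ (1 - c) = (M + 1) * ((M : ℝ) + 1) ^ (-c) := by
      rw [sub_eq_add_neg, Real.rpow_add hM1, Real.rpow_one]
    have e3 : (1 + (1 - c) * -(1 / ((M : ℝ) + 1))) * ((M : ℝ) + 1) ^ (1 - c)
        = ((M : ℝ) + 1) ^ (1 - c) - (1 - c) * ((M : ℝ) + 1) ^ (-c) := by
      rw [e2]
      field_simp
      ring
    rw [e3] at h
    linarith

theorem sum_rpow_neg_tail_le {c : ℝ} (hc : 1 < c) {m : ℕ} (hm : 1 ≤ m) (M : ℕ) :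
    ∑ k ∈ Finset.Ico m M, (k : ℝ) ^ (-c) ≤ c / (c - 1) * (m : ℝ) ^ (1 - c) := by
  have hc1 : 0 < c - 1 := by linarith
  have hm0 : (0 : ℝ) < m := by exact_mod_cast hm
  have hm1 : (1 : ℝ) ≤ m := by exact_mod_cast hm
  -- Keeping the subtracted tail `M^(1-c)/(c-1)` makes the induction telescope. The exponent `c - 1`
  -- may be larger than 1, so the step goes through `1 + x ≤ exp x`.
  have key : ∀ M, m ≤ M → ∑ k ∈ Finset.Ico m (M + 1), (k : ℝ) ^ (-c) ≤
      c / (c - 1) * (m : ℝ) ^ (1 - c) - (M : ℝ) ^ (1 - c) / (c - 1) := by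
    intro M hM
    induction M, hM using Nat.le_induction with
    | base =>
      simp only [Nat.Ico_succ_singleton, Finset.sum_singleton]
      have h1 : (m : ℝ) ^ (-c) ≤ (m : ℝ) ^ (1 - c) :=
        Real.rpow_le_rpow_of_exponent_le hm1 (by linarith)
      have : c / (c - 1) * (m : ℝ) ^ (1 - c) - (m : ℝ) ^ (1 - c) / (c - 1) = (m : ℝ) ^ (1 - c) := by
        field_simp
      linarith
    | succ M hM ih =>
      rw [Finset.sum_Ico_succ_top (by omega)]
      have hM0 : (0 : ℝ) < M := by exact_mod_cast hm.trans hM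
      have hM1 : (0 : ℝ) < (M : ℝ) + 1 := by linarith
      push_cast
      have hlt : (M : ℝ) / (M + 1) ≤ Real.exp (-(1 / ((M : ℝ) + 1))) := by
        have := Real.one_sub_le_exp_neg (1 / ((M : ℝ) + 1))
        have e : 1 - (1 / ((M : ℝ) + 1)) = M / (M + 1) := by field_simp; ring
        rwa [e] at this
      have h1 : ((M : ℝ) / (M + 1)) ^ (c - 1) ≤ Real.exp (-((c - 1) / ((M : ℝ) + 1))) := by
        refine (Real.rpow_le_rpow (by positivity) hlt hc1.le).trans (le_of_eq ?_)
        rw [← Real.exp_mul]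
        congr 1
        ring
      have h2 : 1 + (c - 1) / ((M : ℝ) + 1) ≤ (((M : ℝ) / (M + 1)) ^ (c - 1))⁻¹ := by
        calc 1 + (c - 1) / ((M : ℝ) + 1) ≤ Real.exp ((c - 1) / ((M : ℝ) + 1)) := by
              rw [add_comm]; exact Real.add_one_le_exp _
          _ = (Real.exp (-((c - 1) / ((M : ℝ) + 1))))⁻¹ := by rw [Real.exp_neg, inv_inv]
          _ ≤ _ := by gcongr
      rw [Real.div_rpow hM0.le hM1.le, inv_div, ← neg_sub 1 c, Real.rpow_neg hM0.le,
        Real.rpow_neg hM1.le, div_inv_eq_mul, inv_mul_eq_div, neg_sub,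
        le_div_iff₀ (by positivity)] at h2
      have e2 : ((M : ℝ) + 1) ^ (1 - c) = (M + 1) * ((M : ℝ) + 1) ^ (-c) := by
        rw [sub_eq_add_neg, Real.rpow_add hM1, Real.rpow_one]
      have e3 : (1 + (c - 1) / ((M : ℝ) + 1)) * ((M : ℝ) + 1) ^ (1 - c)
          = ((M : ℝ) + 1) ^ (1 - c) + (c - 1) * ((M : ℝ) + 1) ^ (-c) := by
        rw [e2]
        field_simp
      rw [e3] at h2
      have h3 : ((M : ℝ) + 1) ^ (-c) ≤
          (M : ℝ) ^ (1 - c) / (c - 1) - ((M : ℝ) + 1) ^ (1 - c) / (c - 1) := by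
        rw [← sub_div, le_div_iff₀ hc1]
        linarith
      linarith
  have h0 : 0 ≤ c / (c - 1) * (m : ℝ) ^ (1 - c) := by positivity
  rcases Nat.lt_or_ge m M with h | h
  · obtain ⟨M', rfl⟩ : ∃ M', M = M' + 1 := ⟨M - 1, by omega⟩
    refine (key M' (by omega)).trans ?_
    have : 0 ≤ (M' : ℝ) ^ (1 - c) / (c - 1) := by positivity
    linarith
  · rw [Finset.Ico_eq_empty_of_le h]
    simpa using h0

/-- Summation by parts for power sums on the unit circle. -/
theorem norm_one_sub_mul_sum_le (c : ℕ → ℝ) {z : ℂ} (hz : ‖z‖ = 1) {m M : ℕ} (hmM : m ≤ M) :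
    ‖1 - z‖ * ‖∑ k ∈ Finset.Ico m M, (c k : ℂ) * z ^ k‖ ≤
      |c m| + |c M| + ∑ k ∈ Finset.Ico m M, |c (k + 1) - c k| := by
  have key : (1 - z) * ∑ k ∈ Finset.Ico m M, (c k : ℂ) * z ^ k =
      c m * z ^ m - c M * z ^ M + ∑ k ∈ Finset.Ico m M, ((c (k + 1) - c k : ℝ) : ℂ) * z ^ (k + 1) := by
    induction M, hmM using Nat.le_induction with
    | base => simp
    | succ M hM ih =>
      rw [Finset.sum_Ico_succ_top hM, Finset.sum_Ico_succ_top hM, mul_add, ih]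
      push_cast
      ring
  rw [← norm_mul, key]
  refine (norm_add_le _ _).trans (add_le_add ((norm_sub_le _ _).trans (le_of_eq ?_)) ?_)
  · simp [hz]
  · refine (norm_sum_le _ _).trans (le_of_eq (Finset.sum_congr rfl fun k _ => ?_))
    rw [norm_mul, norm_pow, hz, one_pow, mul_one, Complex.norm_real, Real.norm_eq_abs]

theorem norm_one_sub_mul_sum_le_of_antitone (v : ℕ → ℝ) {z : ℂ} (hz : ‖z‖ = 1) {m M : ℕ}
    (hmM : m ≤ M) (hv0 : 0 ≤ v M) (hv : ∀ k, m ≤ k → k < M → v (k + 1) ≤ v k) :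
    ‖1 - z‖ * ‖∑ k ∈ Finset.Ico m M, (v k : ℂ) * z ^ k‖ ≤ 2 * v m := by
  refine (norm_one_sub_mul_sum_le v hz hmM).trans ?_
  have h1 : ∑ k ∈ Finset.Ico m M, |v (k + 1) - v k| = v m - v M := by
    rw [← neg_sub, ← Finset.sum_Ico_sub v hmM, ← Finset.sum_neg_distrib]
    refine Finset.sum_congr rfl fun k hk => ?_
    rw [Finset.mem_Ico] at hk
    rw [abs_of_nonpos (by linarith [hv k hk.1 hk.2])]
  have h2 : 0 ≤ v m - v M := by rw [← h1]; positivity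
  rw [h1, abs_of_nonneg hv0, abs_of_nonneg (by linarith : 0 ≤ v m)]
  linarith

theorem norm_sum_mul_pow_le (c : ℕ → ℝ) {z : ℂ} (hz : ‖z‖ = 1) (s : Finset ℕ) :
    ‖∑ k ∈ s, (c k : ℂ) * z ^ k‖ ≤ ∑ k ∈ s, |c k| := by
  refine (norm_sum_le _ _).trans (le_of_eq (Finset.sum_congr rfl fun k _ => ?_))
  rw [norm_mul, norm_pow, hz, one_pow, mul_one, Complex.norm_real, Real.norm_eq_abs]

namespace PowerRegular

variable {u : ℕ → ℝ} {a b C : ℝ}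

theorem le_mul_rpow (h : PowerRegular u a b C) {k n : ℕ} (hk : 1 ≤ k) (hkn : k ≤ n) :
    u k ≤ C * (u n * (n : ℝ) ^ a) * (k : ℝ) ^ (-a) := by
  have hk0 : (0 : ℝ) < k := by exact_mod_cast hk
  rw [Real.rpow_neg hk0.le, ← div_eq_mul_inv, le_div_iff₀ (by positivity)]
  exact h.incr k n hk hkn

theorem mul_le_mul_rpow (h : PowerRegular u a b C) {k n : ℕ} (hk : 1 ≤ k) (hkn : k ≤ n) :
    (k : ℝ) * u k ≤ C * (u n * (n : ℝ) ^ a) * (k : ℝ) ^ (-(a - 1)) := by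
  have hk0 : (0 : ℝ) < k := by exact_mod_cast hk
  have e : (k : ℝ) ^ (-(a - 1)) = k * (k : ℝ) ^ (-a) := by
    rw [neg_sub, sub_eq_add_neg, Real.rpow_add hk0, Real.rpow_one]
  rw [e]
  have := mul_le_mul_of_nonneg_left (h.le_mul_rpow hk hkn) hk0.le
  linarith

theorem le_mul_rpow_of_le (h : PowerRegular u a b C) {k n : ℕ} (hn : 1 ≤ n) (hkn : n ≤ k) :
    u k ≤ u n * (n : ℝ) ^ b * (k : ℝ) ^ (-b) := by
  have hk0 : (0 : ℝ) < k := by exact_mod_cast hn.trans hkn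
  rw [Real.rpow_neg hk0.le, ← div_eq_mul_inv, le_div_iff₀ (by positivity)]
  exact h.decr n k hn hkn

/-- The cut `m` will be about `1/t`, while every bound has to be expressed at the scale `n`; hence
the two separate indices. -/
theorem sum_mul_le (h : PowerRegular u a b C) (ha1 : 1 < a) (ha2 : a < 2) {m n : ℕ} (hm : 1 ≤ m)
    (hmn : m ≤ n) :
    ∑ k ∈ Finset.Ico 1 m, (k : ℝ) * u k ≤
      C / (2 - a) * (u n * (n : ℝ) ^ a) * (m : ℝ) ^ (2 - a) := by
  have hC := h.one_le
  have hn := h.pos n (hm.trans hmn)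
  have h1 : ∑ k ∈ Finset.Ico 1 m, (k : ℝ) ^ (-(a - 1)) ≤ (m : ℝ) ^ (2 - a) / (2 - a) := by
    have h2 := sum_rpow_neg_le (c := a - 1) (by linarith) (by linarith) m
    have e : 1 - (a - 1) = 2 - a := by ring
    rw [e] at h2
    refine le_trans (Finset.sum_le_sum_of_subset_of_nonneg ?_ ?_) h2
    · exact Finset.Ico_subset_Ico_right (by omega)
    · intro i _ _
      positivity
  calc ∑ k ∈ Finset.Ico 1 m, (k : ℝ) * u k
      ≤ ∑ k ∈ Finset.Ico 1 m, C * (u n * (n : ℝ) ^ a) * (k : ℝ) ^ (-(a - 1)) := by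
        refine Finset.sum_le_sum fun k hk => ?_
        rw [Finset.mem_Ico] at hk
        exact h.mul_le_mul_rpow hk.1 (by omega)
    _ = C * (u n * (n : ℝ) ^ a) * ∑ k ∈ Finset.Ico 1 m, (k : ℝ) ^ (-(a - 1)) := by
        rw [Finset.mul_sum]
    _ ≤ C * (u n * (n : ℝ) ^ a) * ((m : ℝ) ^ (2 - a) / (2 - a)) := by gcongr
    _ = _ := by ring

/-- The sequence `k u_k` need not be monotone, but its variation from `m` on is at most `C ∑ u_k`,
which is controlled by `∑ k^(-a)`. Convergence of this series is where `a > 1` enters. -/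
theorem norm_one_sub_mul_sum_mul_le (h : PowerRegular u a b C) (ha1 : 1 < a) {m n : ℕ}
    (hm : 1 ≤ m) (hmn : m ≤ n) {z : ℂ} (hz : ‖z‖ = 1) :
    ‖1 - z‖ * ‖∑ k ∈ Finset.Ico m n, (((k : ℝ) * u k : ℝ) : ℂ) * z ^ k‖ ≤
      (2 * C + C ^ 2 * (a / (a - 1))) * (u n * (n : ℝ) ^ a) * (m : ℝ) ^ (1 - a) := by
  have hC := h.one_le
  have hn1 := hm.trans hmn
  have hn := h.pos n hn1
  have hum := h.pos m hm
  have hm0 : (0 : ℝ) < m := by exact_mod_cast hm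
  have hmn' : (m : ℝ) ≤ n := by exact_mod_cast hmn
  have hn0 : (0 : ℝ) < n := by linarith
  refine (norm_one_sub_mul_sum_le (fun k => (k : ℝ) * u k) hz hmn).trans ?_
  have e : -(a - 1) = 1 - a := by ring
  have h1 : |(m : ℝ) * u m| ≤ C * (u n * (n : ℝ) ^ a) * (m : ℝ) ^ (1 - a) := by
    rw [abs_of_pos (by positivity), ← e]
    exact h.mul_le_mul_rpow hm hmn
  have h2 : |(n : ℝ) * u n| ≤ C * (u n * (n : ℝ) ^ a) * (m : ℝ) ^ (1 - a) := by
    rw [abs_of_pos (by positivity)]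
    refine (h.mul_le_mul_rpow hn1 le_rfl).trans ?_
    rw [e]
    gcongr C * (u n * (n : ℝ) ^ a) * ?_
    exact Real.rpow_le_rpow_of_nonpos hm0 hmn' (by linarith)
  have h3 : ∑ k ∈ Finset.Ico m n, |((k + 1 : ℕ) : ℝ) * u (k + 1) - (k : ℝ) * u k| ≤
      C ^ 2 * (a / (a - 1)) * (u n * (n : ℝ) ^ a) * (m : ℝ) ^ (1 - a) := by
    calc ∑ k ∈ Finset.Ico m n, |((k + 1 : ℕ) : ℝ) * u (k + 1) - (k : ℝ) * u k|
        ≤ ∑ k ∈ Finset.Ico m n, C * (C * (u n * (n : ℝ) ^ a) * (k : ℝ) ^ (-a)) := by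
          refine Finset.sum_le_sum fun k hk => ?_
          rw [Finset.mem_Ico] at hk
          have hv := h.var k (by omega)
          push_cast
          refine hv.trans ?_
          gcongr
          exact h.le_mul_rpow (by omega) (by omega)
      _ = C ^ 2 * (u n * (n : ℝ) ^ a) * ∑ k ∈ Finset.Ico m n, (k : ℝ) ^ (-a) := by
          rw [Finset.mul_sum]
          refine Finset.sum_congr rfl fun k _ => ?_
          ring
      _ ≤ C ^ 2 * (u n * (n : ℝ) ^ a) * (a / (a - 1) * (m : ℝ) ^ (1 - a)) := by
          gcongr
          exact sum_rpow_neg_tail_le ha1 hm n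
      _ = _ := by ring
  linarith

end PowerRegular

/-! ### Pointwise bounds for the difference kernel. -/

/-- The exponential sum with the coefficients `((1 - k / N)₊ - (1 - k / n)₊) u_k`. -/
noncomputable def fejerDiffSum (u : ℕ → ℝ) (n N : ℕ) (z : ℂ) : ℂ :=
  ((1 / (n : ℝ) - 1 / N : ℝ) : ℂ) * ∑ k ∈ Finset.Ico 1 n, (((k : ℝ) * u k : ℝ) : ℂ) * z ^ k +
    ∑ k ∈ Finset.Ico n N, (((1 - (k : ℝ) / N) * u k : ℝ) : ℂ) * z ^ k

theorem norm_fejerDiffSum_le {u : ℕ → ℝ} {n N : ℕ} (hn : 1 ≤ n) (hnN : n ≤ N) (z : ℂ) :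
    ‖fejerDiffSum u n N z‖ ≤
      1 / (n : ℝ) * ‖∑ k ∈ Finset.Ico 1 n, (((k : ℝ) * u k : ℝ) : ℂ) * z ^ k‖ +
      ‖∑ k ∈ Finset.Ico n N, (((1 - (k : ℝ) / N) * u k : ℝ) : ℂ) * z ^ k‖ := by
  have hn0 : (0 : ℝ) < n := by exact_mod_cast hn
  have hnN' : (n : ℝ) ≤ N := by exact_mod_cast hnN
  have hN0 : (0 : ℝ) < N := by linarith
  refine (norm_add_le _ _).trans ?_
  rw [norm_mul]
  gcongr
  rw [Complex.norm_real, Real.norm_eq_abs, abs_of_nonneg]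
  · have : 0 < 1 / (N : ℝ) := by positivity
    linarith
  · have : 1 / (N : ℝ) ≤ 1 / n := by gcongr
    linarith

namespace PowerRegular

variable {u : ℕ → ℝ} {a b C : ℝ}

theorem norm_sum_mul_pow_le (h : PowerRegular u a b C) (ha1 : 1 < a) (ha2 : a < 2) {m n : ℕ}
    (hm : 1 ≤ m) (hmn : m ≤ n) {z : ℂ} (hz : ‖z‖ = 1) :
    ‖∑ k ∈ Finset.Ico 1 m, (((k : ℝ) * u k : ℝ) : ℂ) * z ^ k‖ ≤
      C / (2 - a) * (u n * (n : ℝ) ^ a) * (m : ℝ) ^ (2 - a) := by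
  refine (PsiBeta.norm_sum_mul_pow_le (fun k => (k : ℝ) * u k) hz _).trans ?_
  refine le_trans (le_of_eq (Finset.sum_congr rfl fun k hk => ?_)) (h.sum_mul_le ha1 ha2 hm hmn)
  rw [Finset.mem_Ico] at hk
  have := h.pos k hk.1
  exact abs_of_nonneg (by positivity)

theorem norm_sum_tail_le (h : PowerRegular u a b C) {n m N : ℕ} (hn : 1 ≤ n) (hmN : m ≤ N)
    {z : ℂ} (hz : ‖z‖ = 1) :
    ‖∑ k ∈ Finset.Ico n m, (((1 - (k : ℝ) / N) * u k : ℝ) : ℂ) * z ^ k‖ ≤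
      u n * (n : ℝ) ^ b * ∑ k ∈ Finset.Ico n m, (k : ℝ) ^ (-b) := by
  refine (PsiBeta.norm_sum_mul_pow_le (fun k => (1 - (k : ℝ) / N) * u k) hz _).trans ?_
  rw [Finset.mul_sum]
  refine Finset.sum_le_sum fun k hk => ?_
  rw [Finset.mem_Ico] at hk
  have hk0 := h.pos k (by omega)
  refine le_trans ?_ (h.le_mul_rpow_of_le hn hk.1)
  have hkN : (k : ℝ) ≤ N := by exact_mod_cast (by omega : k ≤ N)
  have h1 : (k : ℝ) / N ≤ 1 := div_le_one_of_le₀ hkN (by positivity)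
  have h2 : 0 ≤ (k : ℝ) / N := by positivity
  rw [abs_mul, abs_of_nonneg (by linarith : 0 ≤ 1 - (k : ℝ) / N), abs_of_pos hk0]
  nlinarith

/-- The taper `1 - k/N` keeps the coefficients decreasing and makes them vanish at `N`, so summation
by parts leaves a bound free of `N`. -/
theorem norm_one_sub_mul_sum_tail_le (h : PowerRegular u a b C) {m N : ℕ} (hm : 1 ≤ m)
    (hmN : m ≤ N) {z : ℂ} (hz : ‖z‖ = 1) :
    ‖1 - z‖ * ‖∑ k ∈ Finset.Ico m N, (((1 - (k : ℝ) / N) * u k : ℝ) : ℂ) * z ^ k‖ ≤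
      2 * u m := by
  have hN : 1 ≤ N := hm.trans hmN
  have hN0 : (0 : ℝ) < N := by exact_mod_cast hN
  refine (norm_one_sub_mul_sum_le_of_antitone (fun k => (1 - (k : ℝ) / N) * u k) hz hmN ?_
    ?_).trans ?_
  · simp [hN0.ne']
  · intro k hk hkN
    have h1 := h.anti k (k + 1) (by omega) (by omega)
    have h2 := h.pos (k + 1) (by omega)
    have h3 : ((k + 1 : ℕ) : ℝ) / N ≤ 1 := div_le_one_of_le₀ (by exact_mod_cast hkN) hN0.le
    have h4 : (k : ℝ) / N ≤ ((k + 1 : ℕ) : ℝ) / N := by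
      gcongr
      omega
    exact mul_le_mul (by linarith) h1 h2.le (by linarith)
  · have h1 := h.pos m hm
    have h2 : 0 ≤ (m : ℝ) / N := by positivity
    nlinarith

/-- Uniform bound for the difference kernel when the coefficients are summable. -/
theorem norm_fejerDiffSum_le_of_one_lt (h : PowerRegular u a b C) (ha1 : 1 < a) (ha2 : a < 2)
    (hb : 1 < b) {n N : ℕ} (hn : 1 ≤ n) (hnN : n ≤ N) {z : ℂ} (hz : ‖z‖ = 1) :
    ‖fejerDiffSum u n N z‖ ≤ (C / (2 - a) + b / (b - 1)) * (u n * n) := by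
  have hn0 : (0 : ℝ) < n := by exact_mod_cast hn
  have hun := h.pos n hn
  refine (norm_fejerDiffSum_le hn hnN z).trans ?_
  have h1 := h.norm_sum_mul_pow_le ha1 ha2 hn le_rfl hz
  have h2 := h.norm_sum_tail_le hn (le_refl N) hz (n := n)
  have h3 := sum_rpow_neg_tail_le hb hn N
  have e1 : (n : ℝ) ^ a * (n : ℝ) ^ (2 - a) = n * n := by
    rw [← Real.rpow_add hn0]
    norm_num
    ring
  have e2 : (n : ℝ) ^ b * (n : ℝ) ^ (1 - b) = n := by
    rw [← Real.rpow_add hn0]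
    norm_num
  have h4 : 1 / (n : ℝ) * ‖∑ k ∈ Finset.Ico 1 n, (((k : ℝ) * u k : ℝ) : ℂ) * z ^ k‖ ≤
      C / (2 - a) * (u n * n) := by
    calc _ ≤ 1 / (n : ℝ) * (C / (2 - a) * (u n * (n : ℝ) ^ a) * (n : ℝ) ^ (2 - a)) := by gcongr
      _ = 1 / (n : ℝ) * (C / (2 - a) * u n * ((n : ℝ) ^ a * (n : ℝ) ^ (2 - a))) := by ring
      _ = _ := by rw [e1]; field_simp
  have h5 : u n * (n : ℝ) ^ b * ∑ k ∈ Finset.Ico n N, (k : ℝ) ^ (-b) ≤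
      b / (b - 1) * (u n * n) := by
    calc _ ≤ u n * (n : ℝ) ^ b * (b / (b - 1) * (n : ℝ) ^ (1 - b)) := by gcongr
      _ = b / (b - 1) * (u n * ((n : ℝ) ^ b * (n : ℝ) ^ (1 - b))) := by ring
      _ = _ := by rw [e2]
  linarith

/-- Bound for the difference kernel away from the origin. -/
theorem norm_fejerDiffSum_le_of_inv_le (h : PowerRegular u a b C) (ha1 : 1 < a) (ha2 : a < 2)
    {n N : ℕ} (hn : 1 ≤ n) (hnN : n ≤ N) {z : ℂ} (hz : ‖z‖ = 1) {t : ℝ} (ht0 : 0 < t)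
    (ht4 : t ≤ 4) (hzt : t / 2 ≤ ‖1 - z‖) (hnt : 1 / (n : ℝ) ≤ t) :
    ‖fejerDiffSum u n N z‖ ≤
      (5 * (C / (2 - a)) + 2 * (2 * C + C ^ 2 * (a / (a - 1))) + 4) *
        (u n * (n : ℝ) ^ (a - 1) * t ^ (a - 2)) := by
  have hC := h.one_le
  have hn0 : (0 : ℝ) < n := by exact_mod_cast hn
  have hun := h.pos n hn
  have ha21 : 0 < 2 - a := by linarith
  have ha11 : 0 < a - 1 := by linarith
  have hs : 0 < 1 / t := by positivity
  -- Below frequency `1/t` the oscillation is useless and absolute values are summed; above it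
  -- summation by parts gains a factor `1/t`. Here `m ≤ n`, so the cut falls in the low block.
  set m := ⌈1 / t⌉₊ with hm
  have hm1 : 1 ≤ m := Nat.one_le_iff_ne_zero.mpr (by rw [hm]; exact (Nat.ceil_pos.mpr hs).ne')
  have hmn : m ≤ n := by
    rw [hm, Nat.ceil_le]
    rw [div_le_iff₀ ht0]
    rwa [div_le_iff₀ hn0, mul_comm] at hnt
  have hml : 1 / t ≤ m := Nat.le_ceil _
  have hmu : (m : ℝ) ≤ 5 * (1 / t) := by
    have h1 : (m : ℝ) < 1 / t + 1 := Nat.ceil_lt_add_one hs.le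
    have h2 : 1 ≤ 4 * (1 / t) := by rw [mul_one_div, le_div_iff₀ ht0]; linarith
    linarith
  have hm0 : (0 : ℝ) < m := by exact_mod_cast hm1
  have hd : 0 < ‖1 - z‖ := by linarith
  have hdinv : ∀ X Y : ℝ, 0 ≤ Y → ‖1 - z‖ * X ≤ Y → X ≤ 2 * Y * (1 / t) := by
    intro X Y hY hXY
    have h1 : X ≤ Y / ‖1 - z‖ := by rw [le_div_iff₀ hd]; linarith
    refine h1.trans ?_
    rw [div_le_iff₀ hd, mul_assoc]
    have : 1 ≤ 2 * (1 / t) * ‖1 - z‖ := by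
      calc (1 : ℝ) = 2 * (1 / t) * (t / 2) := by field_simp
        _ ≤ _ := by gcongr
    nlinarith
  have e1 : (1 / t) ^ (2 - a) = t ^ (a - 2) := by
    rw [one_div, Real.inv_rpow ht0.le, ← Real.rpow_neg ht0.le, neg_sub]
  have e2 : (1 / t) ^ (1 - a) * (1 / t) = t ^ (a - 2) := by
    rw [← e1, ← Real.rpow_add_one hs.ne']
    congr 1
    ring
  have e3 : (n : ℝ) ^ a = n * (n : ℝ) ^ (a - 1) := by
    rw [← Real.rpow_one_add' hn0.le (by linarith)]
    congr 1
    ring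
  set W := u n * (n : ℝ) ^ (a - 1) * t ^ (a - 2) with hW
  have hW0 : 0 < W := by positivity
  have hlow1 : 1 / (n : ℝ) * ‖∑ k ∈ Finset.Ico 1 m, (((k : ℝ) * u k : ℝ) : ℂ) * z ^ k‖ ≤
      5 * (C / (2 - a)) * W := by
    have h1 := h.norm_sum_mul_pow_le ha1 ha2 hm1 hmn hz
    have h2 : (m : ℝ) ^ (2 - a) ≤ 5 * t ^ (a - 2) := by
      calc (m : ℝ) ^ (2 - a) ≤ (5 * (1 / t)) ^ (2 - a) := by gcongr
        _ = 5 ^ (2 - a) * t ^ (a - 2) := by rw [Real.mul_rpow (by norm_num) hs.le, e1]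
        _ ≤ 5 ^ (1 : ℝ) * t ^ (a - 2) := by gcongr <;> linarith
        _ = 5 * t ^ (a - 2) := by norm_num
    calc _ ≤ 1 / (n : ℝ) * (C / (2 - a) * (u n * (n : ℝ) ^ a) * (5 * t ^ (a - 2))) := by
          gcongr
          refine h1.trans ?_
          gcongr
      _ = _ := by rw [hW, e3]; field_simp
  have hlow2 : 1 / (n : ℝ) * ‖∑ k ∈ Finset.Ico m n, (((k : ℝ) * u k : ℝ) : ℂ) * z ^ k‖ ≤
      2 * (2 * C + C ^ 2 * (a / (a - 1))) * W := by
    have h1 := hdinv _ _ (by positivity) (h.norm_one_sub_mul_sum_mul_le ha1 hm1 hmn hz)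
    have h2 : (m : ℝ) ^ (1 - a) ≤ (1 / t) ^ (1 - a) :=
      Real.rpow_le_rpow_of_nonpos hs hml (by linarith)
    calc _ ≤ 1 / (n : ℝ) * (2 * ((2 * C + C ^ 2 * (a / (a - 1))) * (u n * (n : ℝ) ^ a) *
            (1 / t) ^ (1 - a)) * (1 / t)) := by
          gcongr
          refine h1.trans ?_
          gcongr
      _ = 1 / (n : ℝ) * (2 * (2 * C + C ^ 2 * (a / (a - 1))) * (u n * (n : ℝ) ^ a) *
            ((1 / t) ^ (1 - a) * (1 / t))) := by ring
      _ = _ := by rw [hW, e2, e3]; field_simp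
  have hhigh : ‖∑ k ∈ Finset.Ico n N, (((1 - (k : ℝ) / N) * u k : ℝ) : ℂ) * z ^ k‖ ≤ 4 * W := by
    have h1 := hdinv _ _ (by positivity) (h.norm_one_sub_mul_sum_tail_le hn hnN hz)
    refine h1.trans ?_
    have h3 : (1 / t) ^ (a - 1) ≤ (n : ℝ) ^ (a - 1) := by
      gcongr
      rw [div_le_iff₀ ht0]
      rwa [div_le_iff₀ hn0, mul_comm] at hnt
    have h2 : 1 / t ≤ (n : ℝ) ^ (a - 1) * t ^ (a - 2) := by
      calc 1 / t = (1 / t) ^ (a - 1) * (1 / t) ^ (2 - a) := by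
            rw [← Real.rpow_add hs]
            norm_num
        _ ≤ _ := by rw [e1]; gcongr
    calc 2 * (2 * u n) * (1 / t) ≤ 2 * (2 * u n) * ((n : ℝ) ^ (a - 1) * t ^ (a - 2)) := by gcongr
      _ = _ := by rw [hW]; ring
  refine (norm_fejerDiffSum_le hn hnN z).trans ?_
  have hsplit : ‖∑ k ∈ Finset.Ico 1 n, (((k : ℝ) * u k : ℝ) : ℂ) * z ^ k‖ ≤
      ‖∑ k ∈ Finset.Ico 1 m, (((k : ℝ) * u k : ℝ) : ℂ) * z ^ k‖ +
      ‖∑ k ∈ Finset.Ico m n, (((k : ℝ) * u k : ℝ) : ℂ) * z ^ k‖ := by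
    rw [← Finset.sum_Ico_consecutive _ hm1 hmn]
    exact norm_add_le _ _
  have hfin := mul_le_mul_of_nonneg_left hsplit (by positivity : 0 ≤ 1 / (n : ℝ))
  rw [mul_add] at hfin
  linarith

/-- Bound for the difference kernel near the origin. -/
theorem norm_fejerDiffSum_le_of_lt_inv (h : PowerRegular u a b C) (ha1 : 1 < a) (ha2 : a < 2)
    (hb0 : 0 < b) (hb : b < 1) {n N : ℕ} (hn : 1 ≤ n) (hnN : n ≤ N) {z : ℂ} (hz : ‖z‖ = 1)
    {t : ℝ} (ht0 : 0 < t) (hzt : t / 2 ≤ ‖1 - z‖) (hnt : t < 1 / (n : ℝ)) :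
    ‖fejerDiffSum u n N z‖ ≤
      (C / (2 - a) + 2 / (1 - b) + 4) * (u n * (n : ℝ) ^ b * t ^ (b - 1)) := by
  have hC := h.one_le
  have hn0 : (0 : ℝ) < n := by exact_mod_cast hn
  have hn1 : (1 : ℝ) ≤ n := by exact_mod_cast hn
  have hun := h.pos n hn
  have ha21 : 0 < 2 - a := by linarith
  have hb1 : 0 < 1 - b := by linarith
  have hs : 0 < 1 / t := by positivity
  have hns : (n : ℝ) ≤ 1 / t := by
    rw [le_div_iff₀ ht0]
    rw [lt_div_iff₀ hn0] at hnt
    linarith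
  -- Now `1/t > n`, so the cut falls in the high block.
  set m := ⌈1 / t⌉₊ with hm
  have hml : 1 / t ≤ m := Nat.le_ceil _
  have hnm : n ≤ m := by exact_mod_cast hns.trans hml
  have hm1 : 1 ≤ m := hn.trans hnm
  have hmu : (m : ℝ) ≤ 2 * (1 / t) := by
    have h1 : (m : ℝ) < 1 / t + 1 := Nat.ceil_lt_add_one hs.le
    linarith
  have hd : 0 < ‖1 - z‖ := by linarith
  have e1 : (1 / t) ^ (1 - b) = t ^ (b - 1) := by
    rw [one_div, Real.inv_rpow ht0.le, ← Real.rpow_neg ht0.le, neg_sub]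
  set W := u n * (n : ℝ) ^ b * t ^ (b - 1) with hW
  have hW0 : 0 < W := by positivity
  have hlow : 1 / (n : ℝ) * ‖∑ k ∈ Finset.Ico 1 n, (((k : ℝ) * u k : ℝ) : ℂ) * z ^ k‖ ≤
      C / (2 - a) * W := by
    have h1 := h.norm_sum_mul_pow_le ha1 ha2 hn le_rfl hz
    have e2 : (n : ℝ) ^ a * (n : ℝ) ^ (2 - a) = n * ((n : ℝ) ^ b * (n : ℝ) ^ (1 - b)) := by
      rw [← Real.rpow_add hn0, ← Real.rpow_add hn0]
      norm_num
      ring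
    calc _ ≤ 1 / (n : ℝ) * (C / (2 - a) * (u n * (n : ℝ) ^ a) * (n : ℝ) ^ (2 - a)) := by gcongr
      _ = 1 / (n : ℝ) * (C / (2 - a) * u n * ((n : ℝ) ^ a * (n : ℝ) ^ (2 - a))) := by ring
      _ = C / (2 - a) * (u n * (n : ℝ) ^ b * (n : ℝ) ^ (1 - b)) := by rw [e2]; field_simp
      _ ≤ C / (2 - a) * (u n * (n : ℝ) ^ b * (1 / t) ^ (1 - b)) := by gcongr
      _ = _ := by rw [e1]
  have hpow : ∀ r : ℕ, r ≤ m → ∑ k ∈ Finset.Ico n r, (k : ℝ) ^ (-b) ≤ 2 / (1 - b) * t ^ (b - 1) := by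
    intro r hr
    calc ∑ k ∈ Finset.Ico n r, (k : ℝ) ^ (-b) ≤ ∑ k ∈ Finset.Ico 1 (m + 1), (k : ℝ) ^ (-b) := by
          refine Finset.sum_le_sum_of_subset_of_nonneg ?_ ?_
          · exact Finset.Ico_subset_Ico hn (by omega)
          · intro i _ _
            positivity
      _ ≤ (m : ℝ) ^ (1 - b) / (1 - b) := sum_rpow_neg_le hb0.le hb m
      _ ≤ (2 * (1 / t)) ^ (1 - b) / (1 - b) := by gcongr
      _ = 2 ^ (1 - b) * t ^ (b - 1) / (1 - b) := by rw [Real.mul_rpow (by norm_num) hs.le, e1]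
      _ ≤ 2 ^ (1 : ℝ) * t ^ (b - 1) / (1 - b) := by gcongr <;> linarith
      _ = _ := by rw [Real.rpow_one]; ring
  have hhead : ∀ r : ℕ, r ≤ m → r ≤ N →
      ‖∑ k ∈ Finset.Ico n r, (((1 - (k : ℝ) / N) * u k : ℝ) : ℂ) * z ^ k‖ ≤ 2 / (1 - b) * W := by
    intro r hr hrN
    calc _ ≤ u n * (n : ℝ) ^ b * ∑ k ∈ Finset.Ico n r, (k : ℝ) ^ (-b) :=
          h.norm_sum_tail_le hn hrN hz
      _ ≤ u n * (n : ℝ) ^ b * (2 / (1 - b) * t ^ (b - 1)) := by gcongr; exact hpow r hr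
      _ = _ := by rw [hW]; ring
  have hhigh : ‖∑ k ∈ Finset.Ico n N, (((1 - (k : ℝ) / N) * u k : ℝ) : ℂ) * z ^ k‖ ≤
      (2 / (1 - b) + 4) * W := by
    -- If `N` comes before the cut, the whole block is estimated by absolute values; otherwise the
    -- part from `m` on is summed by parts.
    rcases le_total N m with hNm | hmN
    · have := hhead N hNm le_rfl
      linarith
    · rw [← Finset.sum_Ico_consecutive _ hnm hmN, add_mul]
      refine (norm_add_le _ _).trans (add_le_add (hhead m le_rfl hmN) ?_)
      have h1 := h.norm_one_sub_mul_sum_tail_le hm1 hmN hz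
      have h2 : u m ≤ u n * (n : ℝ) ^ b * (1 / t) ^ (-b) := by
        refine (h.le_mul_rpow_of_le hn hnm).trans ?_
        gcongr u n * (n : ℝ) ^ b * ?_
        exact Real.rpow_le_rpow_of_nonpos hs hml (by linarith)
      have e3 : (1 / t) ^ (-b) * (1 / t) = t ^ (b - 1) := by
        rw [← e1, ← Real.rpow_add_one hs.ne']
        congr 1
        ring
      have h3 : 4 * W * (t / 2) = 2 * (u n * (n : ℝ) ^ b * (1 / t) ^ (-b)) := by
        rw [hW, ← e3]
        field_simp
        ring
      refine le_of_mul_le_mul_left ?_ hd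
      calc _ ≤ 2 * u m := h1
        _ ≤ 4 * W * (t / 2) := by linarith
        _ ≤ 4 * W * ‖1 - z‖ := by gcongr
        _ = _ := by ring
  refine (norm_fejerDiffSum_le hn hnN z).trans ?_
  linarith

end PowerRegular

/-! ### Orthogonality, the Fejér kernel and Fejér's theorem. -/

theorem integral_cos_int_mul_add {m : ℤ} (hm : m ≠ 0) (c : ℝ) :
    ∫ t in (0 : ℝ)..(2 * π), Real.cos (m * t + c) = 0 := by
  have hm' : (m : ℝ) ≠ 0 := by exact_mod_cast hm
  rw [intervalIntegral.integral_comp_mul_add (fun t => Real.cos t) hm' c, integral_cos]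
  have : (m : ℝ) * (2 * π) + c = c + m * (2 * π) := by ring
  rw [this, Real.sin_add_int_mul_two_pi]
  simp

theorem integral_cos_mul_cos {k l : ℕ} (hkl : 1 ≤ k + l) (c d : ℝ) :
    ∫ t in (0 : ℝ)..(2 * π), Real.cos (k * t + c) * Real.cos (l * t + d) =
      if k = l then π * Real.cos (c - d) else 0 := by
  have h1 : ∀ t : ℝ, Real.cos (k * t + c) * Real.cos (l * t + d) =
      1 / 2 * Real.cos (((k + l : ℤ) : ℝ) * t + (c + d)) +
      1 / 2 * Real.cos (((k - l : ℤ) : ℝ) * t + (c - d)) := by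
    intro t
    push_cast
    have e1 : ((k : ℝ) + l) * t + (c + d) = (k * t + c) + (l * t + d) := by ring
    have e2 : ((k : ℝ) - l) * t + (c - d) = (k * t + c) - (l * t + d) := by ring
    rw [e1, e2, Real.cos_add (k * t + c) (l * t + d), Real.cos_sub (k * t + c) (l * t + d)]
    ring
  simp_rw [h1]
  rw [intervalIntegral.integral_add (Continuous.intervalIntegrable (by fun_prop) _ _)
    (Continuous.intervalIntegrable (by fun_prop) _ _), intervalIntegral.integral_const_mul,
    intervalIntegral.integral_const_mul, integral_cos_int_mul_add (by omega)]
  split_ifs with h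
  · subst h
    simp
    ring
  · rw [integral_cos_int_mul_add (by omega)]
    simp

theorem integral_comp_sub_of_periodic {h : ℝ → ℝ} (hp : Function.Periodic h (2 * π)) (x : ℝ) :
    ∫ t in (0 : ℝ)..(2 * π), h (x - t) = ∫ t in (-π)..π, h t := by
  rw [intervalIntegral.integral_comp_sub_left (fun t => h t)]
  have := hp.intervalIntegral_add_eq (x - 2 * π) (-π)
  have e1 : x - 2 * π + 2 * π = x - 0 := by ring
  have e2 : -π + 2 * π = π := by ring
  rw [e1, e2] at this
  exact this

theorem integral_period {h : ℝ → ℝ} (hp : Function.Periodic h (2 * π)) :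
    ∫ t in (-π)..π, h t = ∫ t in (0 : ℝ)..(2 * π), h t := by
  have := hp.intervalIntegral_add_eq (-π) 0
  have e2 : -π + 2 * π = π := by ring
  rw [e2, zero_add] at this
  exact this

theorem periodic_nat_mul {h : ℝ → ℝ} (hp : Function.Periodic h (2 * π)) (k : ℕ) (c : ℝ) :
    Function.Periodic (fun t => h (k * t + c)) (2 * π) := by
  intro t
  have : (k : ℝ) * (t + 2 * π) + c = k * t + c + k * (2 * π) := by ring
  simp only
  rw [this, hp.nat_mul k]

/-- The Fejér kernel, normalized to have mean value one. -/
noncomputable def fejerKernel (N : ℕ) (t : ℝ) : ℝ :=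
  1 + 2 * ∑ k ∈ Finset.Ico 1 N, (1 - (k : ℝ) / N) * Real.cos (k * t)

theorem continuous_fejerKernel (N : ℕ) : Continuous (fejerKernel N) := by
  unfold fejerKernel
  fun_prop

theorem periodic_fejerKernel (N : ℕ) : Function.Periodic (fejerKernel N) (2 * π) := by
  intro t
  unfold fejerKernel
  have h : ∀ k : ℕ, Real.cos (k * (t + 2 * π)) = Real.cos (k * t) := by
    intro k
    have := periodic_nat_mul Real.cos_periodic k 0 t
    simpa using this
  simp_rw [h]

/-- The right side is `|∑_{k<N} e^{ikt}|²`; passing from `N` to `N + 1` adds 1 and the cross terms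
`2 cos((N - k)t)`. Positivity and the maximal value `N` of the kernel follow from it. -/
theorem natCast_mul_fejerKernel {N : ℕ} (hN : 1 ≤ N) (t : ℝ) :
    (N : ℝ) * fejerKernel N t =
      (∑ k ∈ Finset.range N, Real.cos (k * t)) ^ 2 + (∑ k ∈ Finset.range N, Real.sin (k * t)) ^ 2 := by
  have h1 : (N : ℝ) * fejerKernel N t =
      N + 2 * ∑ k ∈ Finset.range N, ((N : ℝ) - (k + 1 : ℕ)) * Real.cos ((k + 1 : ℕ) * t) := by
    have hN0 : (N : ℝ) ≠ 0 := by positivity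
    unfold fejerKernel
    have e : ∑ k ∈ Finset.range N, ((N : ℝ) - (k + 1 : ℕ)) * Real.cos ((k + 1 : ℕ) * t) =
        N * ∑ k ∈ Finset.Ico 1 N, (1 - (k : ℝ) / N) * Real.cos (k * t) := by
      obtain ⟨M, rfl⟩ : ∃ M, N = M + 1 := ⟨N - 1, by omega⟩
      rw [Finset.sum_range_succ, Finset.sum_Ico_eq_sum_range, Finset.mul_sum]
      simp only [sub_self, zero_mul, add_zero]
      refine Finset.sum_congr (by simp) fun k _ => ?_
      rw [add_comm 1 k, ← mul_assoc]
      congr 1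
      field_simp
    rw [e]
    ring
  rw [h1]
  clear h1 hN
  induction N with
  | zero => simp
  | succ N ih =>
    rw [Finset.sum_range_succ, Finset.sum_range_succ (fun k : ℕ => Real.cos (k * t)),
      Finset.sum_range_succ (fun k : ℕ => Real.sin (k * t))]
    have e1 : ∑ k ∈ Finset.range N, (((N + 1 : ℕ) : ℝ) - (k + 1 : ℕ)) * Real.cos ((k + 1 : ℕ) * t) =
        ∑ k ∈ Finset.range N, ((N : ℝ) - (k + 1 : ℕ)) * Real.cos ((k + 1 : ℕ) * t) +
        ∑ k ∈ Finset.range N, Real.cos ((k + 1 : ℕ) * t) := by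
      rw [← Finset.sum_add_distrib]
      refine Finset.sum_congr rfl fun k _ => ?_
      push_cast
      ring
    have e2 : ∑ k ∈ Finset.range N, Real.cos ((k + 1 : ℕ) * t) =
        Real.cos (N * t) * ∑ k ∈ Finset.range N, Real.cos (k * t) +
        Real.sin (N * t) * ∑ k ∈ Finset.range N, Real.sin (k * t) := by
      rw [← Finset.sum_range_reflect, Finset.mul_sum, Finset.mul_sum, ← Finset.sum_add_distrib]
      refine Finset.sum_congr rfl fun k hk => ?_
      rw [Finset.mem_range] at hk
      rw [← Real.cos_sub]
      congr 1
      have : N - 1 - k + 1 = N - k := by omega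
      rw [this, Nat.cast_sub hk.le]
      ring
    rw [e1, e2, sub_self, zero_mul, add_zero]
    push_cast
    push_cast at ih
    linear_combination ih - (Real.sin_sq_add_cos_sq (N * t))

theorem fejerKernel_nonneg {N : ℕ} (hN : 1 ≤ N) (t : ℝ) : 0 ≤ fejerKernel N t := by
  have hN0 : (0 : ℝ) < N := by exact_mod_cast hN
  have h := natCast_mul_fejerKernel hN t
  refine nonneg_of_mul_nonneg_right (a := (N : ℝ)) ?_ hN0
  rw [h]
  positivity

theorem fejerKernel_le {N : ℕ} (hN : 1 ≤ N) (t : ℝ) : fejerKernel N t ≤ N := by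
  have hN0 : (0 : ℝ) < N := by exact_mod_cast hN
  have h0 : fejerKernel N t ≤ fejerKernel N 0 := by
    unfold fejerKernel
    gcongr with k hk
    · rw [Finset.mem_Ico] at hk
      have : (k : ℝ) / N ≤ 1 := div_le_one_of_le₀ (by exact_mod_cast hk.2.le) hN0.le
      linarith
    · simp [Real.cos_le_one]
  have h := natCast_mul_fejerKernel hN 0
  simp only [mul_zero, Real.cos_zero, Real.sin_zero, Finset.sum_const, Finset.card_range,
    nsmul_eq_mul, mul_one] at h
  have : fejerKernel N 0 = N := by
    refine mul_left_cancel₀ hN0.ne' ?_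
    rw [h]
    ring
  linarith

theorem integral_fejerKernel (N : ℕ) : ∫ t in (0 : ℝ)..(2 * π), fejerKernel N t = 2 * π := by
  unfold fejerKernel
  rw [intervalIntegral.integral_add (by simp) (Continuous.intervalIntegrable (by fun_prop) _ _),
    intervalIntegral.integral_const_mul, intervalIntegral.integral_finsetSum
      (fun k _ => Continuous.intervalIntegrable (by fun_prop) _ _), Finset.sum_eq_zero]
  · simp
  · intro k hk
    rw [Finset.mem_Ico] at hk
    rw [intervalIntegral.integral_const_mul]
    have := integral_cos_int_mul_add (m := (k : ℤ)) (by omega) 0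
    simp only [Int.cast_natCast, add_zero] at this
    rw [this, mul_zero]

/-- With the total mass `2π` this gives mass `2π/N` against `1 - cos t`, which is all the
concentration that Fejér's theorem needs. -/
theorem integral_fejerKernel_mul_cos {N : ℕ} (hN : 2 ≤ N) :
    ∫ t in (0 : ℝ)..(2 * π), fejerKernel N t * Real.cos t = 2 * π * (1 - 1 / N) := by
  unfold fejerKernel
  simp_rw [add_mul, one_mul, mul_assoc, Finset.sum_mul, mul_assoc]
  have h : ∀ k : ℕ, 1 ≤ k → ∫ t in (0 : ℝ)..(2 * π), Real.cos (k * t) * Real.cos t =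
      if k = 1 then π else 0 := by
    intro k hk
    have := integral_cos_mul_cos (k := k) (l := 1) (by omega) 0 0
    simpa using this
  rw [intervalIntegral.integral_add (Continuous.intervalIntegrable (by fun_prop) _ _)
    (Continuous.intervalIntegrable (by fun_prop) _ _),
    intervalIntegral.integral_const_mul, intervalIntegral.integral_finsetSum
      (fun k _ => Continuous.intervalIntegrable (by fun_prop) _ _), integral_cos]
  simp_rw [intervalIntegral.integral_const_mul]
  rw [Finset.sum_eq_single_of_mem 1 (by simp; omega)]
  · rw [h 1 le_rfl]
    simp
    ring
  · intro k hk hk1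
    rw [Finset.mem_Ico] at hk
    rw [h k hk.1]
    simp [hk1]

theorem intervalIntegrable_of_periodMeasure {f : ℝ → ℝ} (hf : Integrable f periodMeasure) :
    IntervalIntegrable f volume 0 (2 * π) := by
  rw [intervalIntegrable_iff_integrableOn_Ioc_of_le Real.two_pi_pos.le]
  exact hf

theorem integrable_periodMeasure_of_continuous {f : ℝ → ℝ} (hf : Continuous f) :
    Integrable f periodMeasure := by
  have := hf.intervalIntegrable (μ := volume) 0 (2 * π)
  rw [intervalIntegrable_iff_integrableOn_Ioc_of_le Real.two_pi_pos.le] at this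
  exact this

theorem fourier_term_eq_integral {f : ℝ → ℝ} (hf : Integrable f periodMeasure) (k : ℕ) (x c : ℝ) :
    fourierA f k * Real.cos (k * x - c) + fourierB f k * Real.sin (k * x - c) =
      (1 / π) * ∫ t in (0 : ℝ)..(2 * π), f t * Real.cos (k * (x - t) - c) := by
  have hi := intervalIntegrable_of_periodMeasure hf
  unfold fourierA fourierB
  have h : ∀ t : ℝ, f t * Real.cos (k * (x - t) - c) =
      f t * Real.cos (k * t) * Real.cos (k * x - c) +
      f t * Real.sin (k * t) * Real.sin (k * x - c) := by
    intro t
    have : (k : ℝ) * (x - t) - c = (k * x - c) - k * t := by ring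
    rw [this, Real.cos_sub]
    ring
  simp_rw [h]
  rw [intervalIntegral.integral_add, intervalIntegral.integral_mul_const,
    intervalIntegral.integral_mul_const]
  · ring
  · exact (hi.mul_continuousOn (by fun_prop)).mul_const _
  · exact (hi.mul_continuousOn (by fun_prop)).mul_const _

theorem sum_fourier_term_eq_integral {f : ℝ → ℝ} (hf : Integrable f periodMeasure)
    (s : Finset ℕ) (w : ℕ → ℝ) (x c : ℝ) :
    ∑ k ∈ s, w k * (fourierA f k * Real.cos (k * x - c) + fourierB f k * Real.sin (k * x - c)) =
      (1 / π) * ∫ t in (0 : ℝ)..(2 * π), f t * ∑ k ∈ s, w k * Real.cos (k * (x - t) - c) := by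
  have hi := intervalIntegrable_of_periodMeasure hf
  simp_rw [fourier_term_eq_integral hf, Finset.mul_sum]
  rw [intervalIntegral.integral_finsetSum, Finset.mul_sum]
  · refine Finset.sum_congr rfl fun k _ => ?_
    rw [mul_left_comm, ← intervalIntegral.integral_const_mul]
    simp_rw [mul_left_comm (w k)]
  · intro k _
    exact hi.mul_continuousOn (by fun_prop)

theorem fejerSum_eq_integral {f : ℝ → ℝ} (hf : Integrable f periodMeasure) (N : ℕ) (x : ℝ) :
    fejerSum N f x = (1 / (2 * π)) * ∫ t in (0 : ℝ)..(2 * π), f t * fejerKernel N (x - t) := by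
  have hi := intervalIntegrable_of_periodMeasure hf
  have h := sum_fourier_term_eq_integral hf (Finset.Ico 1 N) (fun k => 1 - (k : ℝ) / N) x 0
  simp only [sub_zero] at h
  unfold fejerSum fejerKernel
  rw [h]
  simp_rw [mul_add, mul_one, mul_left_comm _ (2 : ℝ)]
  rw [intervalIntegral.integral_add hi, intervalIntegral.integral_const_mul]
  · unfold fourierA
    simp
    field_simp
  · exact (hi.mul_continuousOn (by fun_prop)).const_mul 2

/-- Korovkin's majorant: near `x` modulo `2π` continuity gives `ε`; elsewhere `1 - cos(x - t)` stays
away from 0 and absorbs the bound `2M`. -/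
theorem abs_sub_le_add_mul_one_sub_cos {f : ℝ → ℝ} (hf : Continuous f)
    (hp : Function.Periodic f (2 * π)) (x : ℝ) {ε : ℝ} (hε : 0 < ε) :
    ∃ C, 0 ≤ C ∧ ∀ t, |f t - f x| ≤ ε + C * (1 - Real.cos (x - t)) := by
  have hπ := Real.pi_pos
  obtain ⟨M, hM⟩ : ∃ M, ∀ t, |f t| ≤ M := by
    have := hp.isBounded_of_continuous (by positivity) hf
    obtain ⟨M, hM⟩ := this.exists_norm_le
    exact ⟨M, fun t => hM _ ⟨t, rfl⟩⟩
  have hM0 : 0 ≤ M := (abs_nonneg _).trans (hM 0)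
  obtain ⟨δ, hδ, hδf⟩ := Metric.continuous_iff.mp hf x ε hε
  set η := min δ 1 with hη
  have hη0 : 0 < η := by positivity
  have hη1 : η ≤ 1 := min_le_right _ _
  have hcos : 0 < 1 - Real.cos η := by
    have := Real.cos_lt_cos_of_nonneg_of_le_pi le_rfl (by linarith [Real.pi_gt_three]) hη0
    rw [Real.cos_zero] at this
    linarith
  refine ⟨2 * M / (1 - Real.cos η), by positivity, fun t => ?_⟩
  have hper : Function.Periodic (fun t => (f t, Real.cos (x - t))) (2 * π) := by
    intro t
    simp only [Prod.mk.injEq]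
    refine ⟨hp t, ?_⟩
    rw [← sub_sub, Real.cos_sub_two_pi]
  obtain ⟨y, hy, hty⟩ := hper.exists_mem_Ioc (by positivity) t (x - π)
  simp only [Prod.mk.injEq] at hty
  rw [hty.1, hty.2]
  have hc := Real.cos_le_one (x - y)
  rcases lt_or_ge |y - x| η with h | h
  · have h1 := hδf y (by rw [Real.dist_eq]; exact h.trans_le (min_le_left _ _))
    rw [Real.dist_eq] at h1
    have : 0 ≤ 2 * M / (1 - Real.cos η) * (1 - Real.cos (x - y)) := by
      have : 0 ≤ 1 - Real.cos (x - y) := by linarith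
      positivity
    linarith
  · have h1 : Real.cos (x - y) ≤ Real.cos η := by
      rw [← Real.cos_abs (x - y), abs_sub_comm]
      refine Real.cos_le_cos_of_nonneg_of_le_pi hη0.le ?_ h
      rw [abs_le]
      constructor <;> linarith [hy.1, hy.2]
    have h2 : |f y - f x| ≤ 2 * M := by
      refine (abs_sub _ _).trans ?_
      linarith [hM x, hM y]
    have h3 : 2 * M ≤ 2 * M / (1 - Real.cos η) * (1 - Real.cos (x - y)) := by
      rw [div_mul_eq_mul_div, le_div_iff₀ hcos]
      gcongr
    linarith

/-- Fejér's theorem. -/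
theorem tendsto_fejerSum {f : ℝ → ℝ} (hf : Continuous f) (hp : Function.Periodic f (2 * π))
    (x : ℝ) : Tendsto (fun N => fejerSum N f x) atTop (𝓝 (f x)) := by
  rw [Metric.tendsto_atTop]
  intro ε hε
  obtain ⟨C, hC, hfC⟩ := abs_sub_le_add_mul_one_sub_cos hf hp x (half_pos hε)
  obtain ⟨N₀, hN₀⟩ := exists_nat_gt (C / (ε / 2))
  refine ⟨max N₀ 2, fun N hN => ?_⟩
  have hN2 : 2 ≤ N := (le_max_right _ _).trans hN
  have hN0 : (0 : ℝ) < N := by positivity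
  have hNN : (N₀ : ℝ) ≤ N := by exact_mod_cast (le_max_left _ _).trans hN
  have hK := continuous_fejerKernel N
  have hKs : Continuous fun t => fejerKernel N (x - t) := hK.comp (by fun_prop)
  have hper : Function.Periodic (fun t => fejerKernel N t * Real.cos t) (2 * π) := by
    intro t
    simp only
    rw [periodic_fejerKernel N t, Real.cos_add_two_pi]
  have i1 : ∫ t in (0 : ℝ)..(2 * π), fejerKernel N (x - t) = 2 * π := by
    rw [integral_comp_sub_of_periodic (periodic_fejerKernel N),
      integral_period (periodic_fejerKernel N), integral_fejerKernel]
  have i2 : ∫ t in (0 : ℝ)..(2 * π), fejerKernel N (x - t) * Real.cos (x - t) =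
      2 * π * (1 - 1 / N) := by
    rw [integral_comp_sub_of_periodic hper, integral_period hper, integral_fejerKernel_mul_cos hN2]
  have hdiff : fejerSum N f x - f x =
      (1 / (2 * π)) * ∫ t in (0 : ℝ)..(2 * π), (f t - f x) * fejerKernel N (x - t) := by
    rw [fejerSum_eq_integral (integrable_periodMeasure_of_continuous hf)]
    simp_rw [sub_mul]
    rw [intervalIntegral.integral_sub (Continuous.intervalIntegrable (by fun_prop) _ _)
      (Continuous.intervalIntegrable (by fun_prop) _ _), intervalIntegral.integral_const_mul, i1]
    field_simp
  have hbound : |∫ t in (0 : ℝ)..(2 * π), (f t - f x) * fejerKernel N (x - t)| ≤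
      ∫ t in (0 : ℝ)..(2 * π), ((ε / 2 + C) * fejerKernel N (x - t) -
        C * (fejerKernel N (x - t) * Real.cos (x - t))) := by
    refine intervalIntegral.abs_integral_le_integral_abs Real.two_pi_pos.le |>.trans ?_
    refine intervalIntegral.integral_mono_on Real.two_pi_pos.le
      (Continuous.intervalIntegrable (by fun_prop) _ _)
      (Continuous.intervalIntegrable (by fun_prop) _ _) fun t _ => ?_
    have h0 := fejerKernel_nonneg (by omega : 1 ≤ N) (x - t)
    rw [abs_mul, abs_of_nonneg h0]
    have := mul_le_mul_of_nonneg_right (hfC t) h0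
    linarith
  rw [intervalIntegral.integral_sub (Continuous.intervalIntegrable (by fun_prop) _ _)
    (Continuous.intervalIntegrable (by fun_prop) _ _), intervalIntegral.integral_const_mul,
    intervalIntegral.integral_const_mul, i1, i2] at hbound
  have hCN : C / N < ε / 2 := by
    rw [div_lt_iff₀ hN0]
    rw [div_lt_iff₀ (half_pos hε)] at hN₀
    nlinarith
  rw [Real.dist_eq, hdiff, abs_mul, abs_of_pos (by positivity)]
  calc 1 / (2 * π) * |∫ t in (0 : ℝ)..(2 * π), (f t - f x) * fejerKernel N (x - t)|
      ≤ 1 / (2 * π) * ((ε / 2 + C) * (2 * π) - C * (2 * π * (1 - 1 / N))) := by gcongr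
    _ = ε / 2 + C / N := by field_simp; ring
    _ < ε := by linarith

/-! ### Convolution representation of differences of Fejér sums. -/

/-- The kernel of `σ_{N-1} - σ_{n-1}` on functions with a given `(ψ, β)`-derivative. -/
noncomputable def fejerDiffKernel (u : ℕ → ℝ) (γ : ℝ) (n N : ℕ) (t : ℝ) : ℝ :=
  ∑ k ∈ Finset.Ico 1 n, ((1 / (n : ℝ) - 1 / N) * (k * u k)) * Real.cos (k * t - γ) +
    ∑ k ∈ Finset.Ico n N, ((1 - (k : ℝ) / N) * u k) * Real.cos (k * t - γ)

theorem continuous_fejerDiffKernel (u : ℕ → ℝ) (γ : ℝ) (n N : ℕ) :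
    Continuous (fejerDiffKernel u γ n N) := by
  unfold fejerDiffKernel
  fun_prop

theorem periodic_fejerDiffKernel (u : ℕ → ℝ) (γ : ℝ) (n N : ℕ) :
    Function.Periodic (fejerDiffKernel u γ n N) (2 * π) := by
  intro t
  unfold fejerDiffKernel
  have h : ∀ k : ℕ, Real.cos (k * (t + 2 * π) - γ) = Real.cos (k * t - γ) := by
    intro k
    have := periodic_nat_mul Real.cos_periodic k (-γ) t
    simpa [← sub_eq_add_neg] using this
  simp_rw [h]

theorem cos_eq_re (k : ℕ) (t γ : ℝ) :
    Real.cos (k * t - γ) =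
      (Complex.exp (-(Complex.I * γ)) * Complex.exp (Complex.I * t) ^ k).re := by
  rw [← Complex.exp_nat_mul, ← Complex.exp_add]
  have : -(Complex.I * γ) + k * (Complex.I * t) = ((k * t - γ : ℝ) : ℂ) * Complex.I := by
    push_cast
    ring
  rw [this, Complex.exp_ofReal_mul_I_re]

theorem norm_exp_I_mul (t : ℝ) : ‖Complex.exp (Complex.I * t)‖ = 1 := by
  rw [mul_comm, Complex.norm_exp_ofReal_mul_I]

/-- The phase `γ` only contributes a unimodular factor `e^{-iγ}` before the real part is taken, so
all bounds are independent of `β`. -/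
theorem abs_fejerDiffKernel_le (u : ℕ → ℝ) (γ : ℝ) (n N : ℕ) (t : ℝ) :
    |fejerDiffKernel u γ n N t| ≤ ‖fejerDiffSum u n N (Complex.exp (Complex.I * t))‖ := by
  have h : fejerDiffKernel u γ n N t =
      (Complex.exp (-(Complex.I * γ)) * fejerDiffSum u n N (Complex.exp (Complex.I * t))).re := by
    unfold fejerDiffKernel fejerDiffSum
    rw [mul_add, Complex.add_re, Finset.mul_sum, Finset.mul_sum, Finset.mul_sum, Complex.re_sum,
      Complex.re_sum]
    congr 1
    · refine Finset.sum_congr rfl fun k _ => ?_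
      rw [cos_eq_re, ← Complex.re_ofReal_mul]
      congr 1
      push_cast
      ring
    · refine Finset.sum_congr rfl fun k _ => ?_
      rw [cos_eq_re, ← Complex.re_ofReal_mul]
      congr 1
      ring
  have h1 : ‖Complex.exp (-(Complex.I * γ))‖ = 1 := by
    have := norm_exp_I_mul (-γ)
    rwa [Complex.ofReal_neg, mul_neg] at this
  rw [h]
  refine (Complex.abs_re_le_norm _).trans ?_
  rw [norm_mul, h1, one_mul]

theorem half_le_norm_one_sub_exp {t : ℝ} (h : |t| ≤ π) :
    |t| / 2 ≤ ‖1 - Complex.exp (Complex.I * t)‖ := by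
  rw [norm_sub_rev, Complex.norm_exp_I_mul_ofReal_sub_one, Real.norm_eq_abs, abs_mul, abs_two]
  have h1 := Real.mul_abs_le_abs_sin (x := t / 2) (by rw [abs_div, abs_two]; linarith)
  rw [abs_div, abs_two] at h1
  have h2 : |t| / 4 ≤ 2 / π * (|t| / 2) := by
    have : 2 / π * (|t| / 2) = |t| / π := by field_simp
    rw [this]
    gcongr
    exact Real.pi_le_four
  linarith

/-- Taking the `(ψ, β)`-derivative divides the `k`-th harmonic by `ψ(k)` and rotates it by `βπ/2`;
this is inverted term by term. For `k < n` the two Fejér factors differ by `k(1/n - 1/N)`, and the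
constant terms cancel. -/
theorem fejerSum_sub_fejerSum {ψ : ℝ → ℝ} {β : ℝ} {f φ : ℝ → ℝ} (hψ : ∀ k : ℕ, 1 ≤ k → 0 < ψ k)
    (hφ : IsPsiBetaDeriv ψ β f φ) {n N : ℕ} (hn : 1 ≤ n) (hnN : n ≤ N) (x : ℝ) :
    fejerSum N f x - fejerSum n f x =
      (1 / π) * ∫ t in (0 : ℝ)..(2 * π),
        φ t * fejerDiffKernel (fun k : ℕ => ψ k) (β * π / 2) n N (x - t) := by
  obtain ⟨-, ⟨-, hφi⟩, hA, hB⟩ := hφ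
  set γ := β * π / 2 with hγ
  have hi := intervalIntegrable_of_periodMeasure hφi
  have hterm : ∀ k : ℕ, 1 ≤ k → fourierA f k * Real.cos (k * x) + fourierB f k * Real.sin (k * x) =
      ψ k * (fourierA φ k * Real.cos (k * x - γ) + fourierB φ k * Real.sin (k * x - γ)) := by
    intro k hk
    have hk0 : ψ k ≠ 0 := (hψ k hk).ne'
    rw [hA k, hB k hk]
    beta_reduce
    rw [if_neg (by omega), Real.cos_sub, Real.sin_sub]
    field_simp
    linear_combination (-(fourierA f k * Real.cos (k * x) + fourierB f k * Real.sin (k * x))) *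
      Real.sin_sq_add_cos_sq γ
  have hdiff : fejerSum N f x - fejerSum n f x =
      ∑ k ∈ Finset.Ico 1 n, ((1 / (n : ℝ) - 1 / N) * (k * ψ k)) *
        (fourierA φ k * Real.cos (k * x - γ) + fourierB φ k * Real.sin (k * x - γ)) +
      ∑ k ∈ Finset.Ico n N, ((1 - (k : ℝ) / N) * ψ k) *
        (fourierA φ k * Real.cos (k * x - γ) + fourierB φ k * Real.sin (k * x - γ)) := by
    unfold fejerSum
    rw [← Finset.sum_Ico_consecutive _ hn hnN, add_sub_add_left_eq_sub, add_sub_right_comm,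
      ← Finset.sum_sub_distrib]
    congr 1
    · refine Finset.sum_congr rfl fun k hk => ?_
      rw [Finset.mem_Ico] at hk
      rw [hterm k hk.1]
      ring
    · refine Finset.sum_congr rfl fun k hk => ?_
      rw [Finset.mem_Ico] at hk
      rw [hterm k (by omega)]
      ring
  rw [hdiff, sum_fourier_term_eq_integral hφi, sum_fourier_term_eq_integral hφi, ← mul_add,
    ← intervalIntegral.integral_add]
  · congr 1
    refine intervalIntegral.integral_congr fun t _ => ?_
    simp only [fejerDiffKernel]
    ring
  · exact hi.mul_continuousOn (by fun_prop)
  · exact hi.mul_continuousOn (by fun_prop)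

/-! ### The `L_q` norm of the kernel and the upper bound. -/

/-- The `q`-th power integral of a function with two-sided power bounds. -/
theorem integral_abs_rpow_le {h : ℝ → ℝ} (hh : Continuous h) {p q a b D : ℝ}
    (hpq : p.HolderConjugate q) (ha : a < 1 + 1 / p) (hb : 1 / p < b) (hD : 0 ≤ D) {n : ℕ}
    (hn : 1 ≤ n)
    (h1 : ∀ t, 0 < t → t ≤ π → 1 / (n : ℝ) ≤ t → |h t| ≤ D * ((n : ℝ) ^ (a - 1) * t ^ (a - 2)))
    (h2 : ∀ t, 0 < t → t < 1 / (n : ℝ) → |h t| ≤ D * ((n : ℝ) ^ b * t ^ (b - 1))) :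
    ∫ t in (0 : ℝ)..π, |h t| ^ q ≤
      D ^ q * (n : ℝ) ^ (q - 1) * (1 / (q * (b - 1) + 1) + 1 / (q * (2 - a) - 1)) := by
  have hn0 : (0 : ℝ) < n := by exact_mod_cast hn
  have hn1 : (1 : ℝ) ≤ n := by exact_mod_cast hn
  have hq0 := hpq.symm.pos
  have hp0 := hpq.pos
  have hsum : 1 / p + 1 / q = 1 := by
    have := hpq.inv_add_inv_eq_one
    simpa using this
  have hqp : q * (1 / p) = q - 1 := by
    have : 1 / p = 1 - 1 / q := by linarith
    rw [this, mul_sub, mul_one_div_cancel hq0.ne', mul_one]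
  -- These two inequalities are `b > 1/p` and `a < 1 + 1/p` rewritten for the conjugate `q`:
  -- integrability of `t^(q(b-1))` at 0 and of `t^(q(a-2))` at infinity.
  have hr1 : 0 < q * (b - 1) + 1 := by nlinarith
  have hr2 : 0 < q * (2 - a) - 1 := by nlinarith
  have hi0 : (0 : ℝ) < 1 / n := by positivity
  have hiπ : 1 / (n : ℝ) ≤ π := by
    have : 1 / (n : ℝ) ≤ 1 := by rw [div_le_one hn0]; exact hn1
    linarith [Real.pi_gt_three]
  have hc : Continuous fun t => |h t| ^ q := hh.abs.rpow_const fun _ => Or.inr hq0.le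
  rw [← intervalIntegral.integral_add_adjacent_intervals (b := 1 / (n : ℝ))
    (hc.intervalIntegrable _ _) (hc.intervalIntegrable _ _)]
  have hI1 : ∫ t in (0 : ℝ)..(1 / n), |h t| ^ q ≤
      D ^ q * (n : ℝ) ^ (q - 1) * (1 / (q * (b - 1) + 1)) := by
    have hle : ∫ t in (0 : ℝ)..(1 / n), |h t| ^ q ≤
        ∫ t in (0 : ℝ)..(1 / n), D ^ q * (n : ℝ) ^ (b * q) * t ^ (q * (b - 1)) := by
      refine intervalIntegral.integral_mono_on_of_le_Ioo hi0.le (hc.intervalIntegrable _ _)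
        ((intervalIntegral.intervalIntegrable_rpow' (by linarith)).const_mul _) fun t ht => ?_
      refine (Real.rpow_le_rpow (abs_nonneg _) (h2 t ht.1 ht.2) hq0.le).trans (le_of_eq ?_)
      have ht0 := ht.1
      rw [Real.mul_rpow hD (by positivity), Real.mul_rpow (by positivity) (by positivity),
        ← Real.rpow_mul hn0.le, ← Real.rpow_mul ht0.le, mul_comm (b - 1) q, mul_assoc]
    refine hle.trans (le_of_eq ?_)
    rw [intervalIntegral.integral_const_mul, integral_rpow (Or.inl (by linarith)),
      Real.zero_rpow hr1.ne', sub_zero, one_div (n : ℝ), Real.inv_rpow hn0.le,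
      ← Real.rpow_neg hn0.le]
    have : (n : ℝ) ^ (q - 1) = (n : ℝ) ^ (b * q) * (n : ℝ) ^ (-(q * (b - 1) + 1)) := by
      rw [← Real.rpow_add hn0]
      congr 1
      ring
    rw [this]
    ring
  have hI2 : ∫ t in (1 / (n : ℝ))..π, |h t| ^ q ≤
      D ^ q * (n : ℝ) ^ (q - 1) * (1 / (q * (2 - a) - 1)) := by
    have h0 : (0 : ℝ) ∉ Set.uIcc (1 / (n : ℝ)) π := by
      rw [Set.uIcc_of_le hiπ]
      intro h0
      linarith [h0.1]
    have hle : ∫ t in (1 / (n : ℝ))..π, |h t| ^ q ≤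
        ∫ t in (1 / (n : ℝ))..π, D ^ q * (n : ℝ) ^ ((a - 1) * q) * t ^ (q * (a - 2)) := by
      refine intervalIntegral.integral_mono_on hiπ (hc.intervalIntegrable _ _)
        ((intervalIntegral.intervalIntegrable_rpow (Or.inr h0)).const_mul _) fun t ht => ?_
      have ht0 : 0 < t := hi0.trans_le ht.1
      refine (Real.rpow_le_rpow (abs_nonneg _) (h1 t ht0 ht.2 ht.1) hq0.le).trans (le_of_eq ?_)
      rw [Real.mul_rpow hD (by positivity), Real.mul_rpow (by positivity) (by positivity),
        ← Real.rpow_mul hn0.le, ← Real.rpow_mul ht0.le, mul_comm (a - 2) q, mul_assoc]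
    refine hle.trans ?_
    have hne : q * (a - 2) ≠ -1 := by
      intro hne
      linarith
    rw [intervalIntegral.integral_const_mul, integral_rpow (Or.inr ⟨hne, h0⟩)]
    -- The exponent `q(a-2) + 1` is negative; with both signs flipped, the term at `π` is subtracted
    -- and can be dropped.
    have e : (π ^ (q * (a - 2) + 1) - (1 / (n : ℝ)) ^ (q * (a - 2) + 1)) / (q * (a - 2) + 1) =
        ((1 / (n : ℝ)) ^ (q * (a - 2) + 1) - π ^ (q * (a - 2) + 1)) / (q * (2 - a) - 1) := by
      have : q * (a - 2) + 1 = -(q * (2 - a) - 1) := by ring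
      rw [div_eq_div_iff (by rw [this]; linarith) hr2.ne', this]
      ring
    rw [e]
    have h4 : (1 / (n : ℝ)) ^ (q * (a - 2) + 1) = (n : ℝ) ^ (-(q * (a - 2) + 1)) := by
      rw [one_div, Real.inv_rpow hn0.le, ← Real.rpow_neg hn0.le]
    have h5 : (n : ℝ) ^ (q - 1) = (n : ℝ) ^ ((a - 1) * q) * (n : ℝ) ^ (-(q * (a - 2) + 1)) := by
      rw [← Real.rpow_add hn0]
      congr 1
      ring
    calc _ ≤ D ^ q * (n : ℝ) ^ ((a - 1) * q) *
          ((n : ℝ) ^ (-(q * (a - 2) + 1)) / (q * (2 - a) - 1)) := by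
          gcongr
          rw [h4]
          have : 0 < π ^ (q * (a - 2) + 1) := by positivity
          linarith
      _ = _ := by rw [h5]; ring
  rw [mul_add]
  exact add_le_add hI1 hI2

theorem exists_integral_fejerDiffKernel_le {u : ℕ → ℝ} {p q a b C : ℝ}
    (h : PowerRegular u a b C) (hpq : p.HolderConjugate q) (ha1 : 1 < a) (ha : a < 1 + 1 / p)
    (hb : 1 / p < b) (hb1 : b < 1) :
    ∃ K : ℝ, 0 ≤ K ∧ ∀ (γ : ℝ) (n N : ℕ), 1 ≤ n → n ≤ N →
      (∫ t in (-π)..π, |fejerDiffKernel u γ n N t| ^ q) ^ (1 / q) ≤ K * (u n * (n : ℝ) ^ (1 / p)) := by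
  have hq0 := hpq.symm.pos
  have hp0 := hpq.pos
  have hp1 := hpq.lt
  have hC := h.one_le
  have hp' : 1 / p < 1 := by rw [div_lt_one hp0]; exact hp1
  have ha2 : a < 2 := by linarith
  have hp'' : 0 < 1 / p := by positivity
  have hb0 : 0 < b := by linarith
  have hsum : 1 / p + 1 / q = 1 := by
    have := hpq.inv_add_inv_eq_one
    simpa using this
  have hqp : q * (1 / p) = q - 1 := by
    have : 1 / p = 1 - 1 / q := by linarith
    rw [this, mul_sub, mul_one_div_cancel hq0.ne', mul_one]
  have hr1 : 0 < q * (b - 1) + 1 := by nlinarith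
  have hr2 : 0 < q * (2 - a) - 1 := by nlinarith
  have ha21 : 0 < 2 - a := by linarith
  have ha11 : 0 < a - 1 := by linarith
  have hb11 : 0 < 1 - b := by linarith
  set D₀ := max (5 * (C / (2 - a)) + 2 * (2 * C + C ^ 2 * (a / (a - 1))) + 4)
    (C / (2 - a) + 2 / (1 - b) + 4) with hD₀
  have hD0 : 0 ≤ D₀ := le_max_of_le_left (by positivity)
  set G := 1 / (q * (b - 1) + 1) + 1 / (q * (2 - a) - 1) with hG
  have hG0 : 0 < G := by positivity
  refine ⟨D₀ * (2 * G) ^ (1 / q), by positivity, fun γ n N hn hnN => ?_⟩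
  have hn0 : (0 : ℝ) < n := by exact_mod_cast hn
  have hun := h.pos n hn
  have hK := continuous_fejerDiffKernel u γ n N
  have hkey1 : ∀ s t : ℝ, |s| = t → 0 < t → t ≤ π → 1 / (n : ℝ) ≤ t →
      |fejerDiffKernel u γ n N s| ≤ D₀ * u n * ((n : ℝ) ^ (a - 1) * t ^ (a - 2)) := by
    intro s t hst ht0 htπ hnt
    refine (abs_fejerDiffKernel_le u γ n N s).trans ?_
    have hz := half_le_norm_one_sub_exp (t := s) (by rw [hst]; exact htπ)
    rw [hst] at hz
    refine (h.norm_fejerDiffSum_le_of_inv_le ha1 ha2 hn hnN (norm_exp_I_mul s) ht0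
      (htπ.trans Real.pi_le_four) hz hnt).trans ?_
    rw [mul_assoc D₀, ← mul_assoc (u n)]
    gcongr
    exact le_max_left _ _
  have hkey2 : ∀ s t : ℝ, |s| = t → 0 < t → t < 1 / (n : ℝ) →
      |fejerDiffKernel u γ n N s| ≤ D₀ * u n * ((n : ℝ) ^ b * t ^ (b - 1)) := by
    intro s t hst ht0 hnt
    have htπ : t ≤ π := by
      have hn1 : (1 : ℝ) ≤ n := by exact_mod_cast hn
      have : 1 / (n : ℝ) ≤ 1 := by rw [div_le_one hn0]; exact hn1
      linarith [Real.pi_gt_three]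
    refine (abs_fejerDiffKernel_le u γ n N s).trans ?_
    have hz := half_le_norm_one_sub_exp (t := s) (by rw [hst]; exact htπ)
    rw [hst] at hz
    refine (h.norm_fejerDiffSum_le_of_lt_inv ha1 ha2 hb0 hb1 hn hnN (norm_exp_I_mul s) ht0
      hz hnt).trans ?_
    rw [mul_assoc D₀, ← mul_assoc (u n)]
    gcongr
    exact le_max_right _ _
  have hI1 := integral_abs_rpow_le hK hpq ha hb (by positivity : 0 ≤ D₀ * u n) hn
    (fun t ht0 => hkey1 t t (abs_of_pos ht0) ht0) (fun t ht0 => hkey2 t t (abs_of_pos ht0) ht0)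
  -- The pointwise bounds depend only on `|s|`, so the left half of the period is the same estimate
  -- for the reflected kernel; this gives the factor 2 in `2 * G`.
  have hI2 := integral_abs_rpow_le (hK.comp continuous_neg) hpq ha hb
    (by positivity : 0 ≤ D₀ * u n) hn
    (fun t ht0 => hkey1 (-t) t (by rw [abs_neg, abs_of_pos ht0]) ht0)
    (fun t ht0 => hkey2 (-t) t (by rw [abs_neg, abs_of_pos ht0]) ht0)
  have hc : Continuous fun t => |fejerDiffKernel u γ n N t| ^ q :=
    hK.abs.rpow_const fun _ => Or.inr hq0.le
  have hneg : ∫ t in (-π)..0, |fejerDiffKernel u γ n N t| ^ q =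
      ∫ t in (0 : ℝ)..π, |(fejerDiffKernel u γ n N ∘ Neg.neg) t| ^ q := by
    have := intervalIntegral.integral_comp_neg (a := 0) (b := π)
      (fun t => |fejerDiffKernel u γ n N t| ^ q)
    rw [neg_zero] at this
    rw [← this]
    rfl
  have htot : ∫ t in (-π)..π, |fejerDiffKernel u γ n N t| ^ q ≤
      (D₀ * u n) ^ q * (n : ℝ) ^ (q - 1) * (2 * G) := by
    rw [← intervalIntegral.integral_add_adjacent_intervals (b := 0)
      (hc.intervalIntegrable _ _) (hc.intervalIntegrable _ _), hneg]
    linarith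
  have h0 : 0 ≤ ∫ t in (-π)..π, |fejerDiffKernel u γ n N t| ^ q :=
    intervalIntegral.integral_nonneg (by linarith [Real.pi_pos]) fun t _ => by positivity
  refine (Real.rpow_le_rpow h0 htot (by positivity)).trans (le_of_eq ?_)
  rw [Real.mul_rpow (by positivity) (by positivity), Real.mul_rpow (by positivity) (by positivity),
    ← Real.rpow_mul (by positivity), mul_one_div_cancel hq0.ne', Real.rpow_one,
    ← Real.rpow_mul hn0.le]
  have : (q - 1) * (1 / q) = 1 / p := by
    rw [← hqp]
    field_simp
  rw [this]
  ring

theorem integral_norm_rpow_le_one {φ : ℝ → ℝ} {p : ℝ} (hp : 1 ≤ p)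
    (hφ : MemLp φ (ENNReal.ofReal p) periodMeasure)
    (hφ1 : eLpNorm φ (ENNReal.ofReal p) periodMeasure ≤ 1) :
    (∫ t, ‖φ t‖ ^ p ∂periodMeasure) ^ (1 / p) ≤ 1 := by
  have hp0 : 0 < p := by linarith
  rw [hφ.eLpNorm_eq_integral_rpow_norm (by simpa using hp0) ENNReal.ofReal_ne_top,
    ENNReal.ofReal_le_one, ENNReal.toReal_ofReal hp0.le] at hφ1
  rwa [one_div]

theorem intervalIntegral_eq_periodMeasure (h : ℝ → ℝ) :
    ∫ t in (0 : ℝ)..(2 * π), h t = ∫ t, h t ∂periodMeasure :=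
  intervalIntegral.integral_of_le Real.two_pi_pos.le

instance : IsFiniteMeasure periodMeasure := by
  unfold periodMeasure
  infer_instance

theorem memLp_periodMeasure_of_continuous {h : ℝ → ℝ} (hh : Continuous h) (r : ℝ≥0∞) :
    MemLp h r periodMeasure := by
  obtain ⟨M, hM⟩ := isCompact_Icc.exists_bound_of_continuousOn
    (hh.continuousOn (s := Icc 0 (2 * π)))
  refine MemLp.of_bound hh.aestronglyMeasurable M ?_
  refine (ae_restrict_iff' measurableSet_Ioc).mpr (Eventually.of_forall fun t ht => ?_)
  exact hM t (Ioc_subset_Icc_self ht)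

theorem abs_integral_mul_le_of_holderConjugate {φ K : ℝ → ℝ} {p q : ℝ}
    (hpq : p.HolderConjugate q)
    (hφ : MemLp φ (ENNReal.ofReal p) periodMeasure)
    (hφ1 : eLpNorm φ (ENNReal.ofReal p) periodMeasure ≤ 1)
    (hK : Continuous K) (hKp : Function.Periodic K (2 * π)) (x : ℝ) :
    |∫ t in (0 : ℝ)..(2 * π), φ t * K (x - t)| ≤ (∫ t in (-π)..π, |K t| ^ q) ^ (1 / q) := by
  have hKx : Continuous fun t => K (x - t) := hK.comp (by fun_prop)
  have hper : Function.Periodic (fun t => |K t| ^ q) (2 * π) := fun t => by simp only [hKp t]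
  have h1 := integral_mul_norm_le_Lp_mul_Lq hpq hφ
    (memLp_periodMeasure_of_continuous hKx (ENNReal.ofReal q))
  have h2 := integral_norm_rpow_le_one hpq.lt.le hφ hφ1
  have h3 : ∫ t, ‖K (x - t)‖ ^ q ∂periodMeasure = ∫ t in (-π)..π, |K t| ^ q := by
    rw [← intervalIntegral_eq_periodMeasure]
    exact integral_comp_sub_of_periodic hper x
  rw [h3] at h1
  have h0 : 0 ≤ (∫ t in (-π)..π, |K t| ^ q) ^ (1 / q) := by
    refine Real.rpow_nonneg (intervalIntegral.integral_nonneg (by linarith [Real.pi_pos])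
      fun t _ => by positivity) _
  rw [intervalIntegral_eq_periodMeasure, ← Real.norm_eq_abs]
  refine (norm_integral_le_integral_norm _).trans ?_
  simp_rw [norm_mul]
  refine h1.trans ?_
  nlinarith

theorem abs_integral_mul_le_of_bound {φ K : ℝ → ℝ} {B : ℝ}
    (hφ : MemLp φ (ENNReal.ofReal 1) periodMeasure)
    (hφ1 : eLpNorm φ (ENNReal.ofReal 1) periodMeasure ≤ 1)
    (hB : 0 ≤ B) (hKB : ∀ t, |K t| ≤ B) (x : ℝ) :
    |∫ t in (0 : ℝ)..(2 * π), φ t * K (x - t)| ≤ B := by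
  have h2 := integral_norm_rpow_le_one le_rfl hφ hφ1
  simp only [Real.rpow_one, div_one] at h2
  rw [ENNReal.ofReal_one] at hφ
  rw [intervalIntegral_eq_periodMeasure, ← Real.norm_eq_abs]
  calc ‖∫ t, φ t * K (x - t) ∂periodMeasure‖ ≤ ∫ t, ‖φ t‖ * B ∂periodMeasure := by
        refine norm_integral_le_of_norm_le ((memLp_one_iff_integrable.mp hφ).norm.mul_const B)
          (Eventually.of_forall fun t => ?_)
        rw [norm_mul]
        gcongr
        exact hKB _
    _ = (∫ t, ‖φ t‖ ∂periodMeasure) * B := integral_mul_const _ _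
    _ ≤ B := by nlinarith

/-- Letting `N → ∞` in Fejér's theorem replaces any discussion of an infinite kernel; the factor
`1/π` is bounded by 1. -/
theorem abs_sub_fejerSum_le_of_kernel {ψ : ℝ → ℝ} {β p : ℝ} (hψ : ∀ k : ℕ, 1 ≤ k → 0 < ψ k)
    {n : ℕ} (hn : 1 ≤ n) {B : ℝ}
    (hB : ∀ φ : ℝ → ℝ, MemLp φ (ENNReal.ofReal p) periodMeasure →
      eLpNorm φ (ENNReal.ofReal p) periodMeasure ≤ 1 → ∀ N, n ≤ N → ∀ x,
      |∫ t in (0 : ℝ)..(2 * π),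
        φ t * fejerDiffKernel (fun k : ℕ => ψ k) (β * π / 2) n N (x - t)| ≤ B)
    {f : ℝ → ℝ} (hf : f ∈ classC ψ β p) (x : ℝ) : |f x - fejerSum n f x| ≤ B := by
  obtain ⟨hfc, hfp, φ, hφ, hφp, hφ1⟩ := hf
  have hlim : Tendsto (fun N => |fejerSum N f x - fejerSum n f x|) atTop
      (𝓝 |f x - fejerSum n f x|) := ((tendsto_fejerSum hfc hfp x).sub_const _).abs
  refine le_of_tendsto hlim ?_
  filter_upwards [eventually_ge_atTop n] with N hN
  rw [fejerSum_sub_fejerSum hψ hφ hn hN x, abs_mul, abs_of_pos (by positivity)]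
  have h1 := hB φ hφp hφ1 N hN x
  have h2 : 1 / π ≤ 1 := by rw [div_le_one Real.pi_pos]; linarith [Real.pi_gt_three]
  have h3 : 0 < 1 / π := by positivity
  nlinarith [abs_nonneg (∫ t in (0 : ℝ)..(2 * π),
        φ t * fejerDiffKernel (fun k : ℕ => ψ k) (β * π / 2) n N (x - t))]

theorem exists_abs_sub_fejerSum_le {ψ : ℝ → ℝ} {β p a b C : ℝ} (hp : 1 ≤ p) (ha1 : 1 < a)
    (ha : a < 1 + 1 / p) (hb : 1 / p < b) (hb1 : 1 < p → b < 1)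
    (h : PowerRegular (fun k : ℕ => ψ k) a b C) :
    ∃ K : ℝ, 0 ≤ K ∧ ∀ n : ℕ, 1 ≤ n → ∀ f ∈ classC ψ β p, ∀ x,
      |f x - fejerSum n f x| ≤ K * (ψ n * (n : ℝ) ^ (1 / p)) := by
  have hC := h.one_le
  rcases eq_or_lt_of_le hp with rfl | hp1
  · have hb' : 1 < b := by linarith [div_one (1 : ℝ)]
    have ha2 : a < 2 := by linarith [div_one (1 : ℝ)]
    have h2a : 0 < 2 - a := by linarith
    have hb'' : 0 < b - 1 := by linarith
    refine ⟨C / (2 - a) + b / (b - 1), by positivity, fun n hn f hf x => ?_⟩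
    have hun : 0 < ψ n := h.pos n hn
    refine abs_sub_fejerSum_le_of_kernel h.pos hn (fun φ hφ hφ1 N hN x => ?_) hf x
    rw [div_one, Real.rpow_one]
    refine abs_integral_mul_le_of_bound hφ hφ1 (by positivity) (fun t => ?_) x
    exact (abs_fejerDiffKernel_le _ _ _ _ _).trans
      (h.norm_fejerDiffSum_le_of_one_lt ha1 ha2 hb' hn hN (norm_exp_I_mul t))
  · have hpq := Real.HolderConjugate.conjExponent hp1
    obtain ⟨K, hK, hKn⟩ := exists_integral_fejerDiffKernel_le h hpq ha1 ha hb (hb1 hp1)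
    refine ⟨K, hK, fun n hn f hf x => ?_⟩
    refine abs_sub_fejerSum_le_of_kernel h.pos hn (fun φ hφ hφ1 N hN x => ?_) hf x
    exact (abs_integral_mul_le_of_holderConjugate hpq hφ hφ1 (continuous_fejerDiffKernel _ _ _ _)
      (periodic_fejerDiffKernel _ _ _ _) x).trans (hKn _ n N hn hN)

/-! ### The extremal polynomial and the lower bound. -/

/-- The polynomial `∑_{k ∈ s} w_k cos (k x + γ)`. -/
noncomputable def cosSum (s : Finset ℕ) (w : ℕ → ℝ) (γ x : ℝ) : ℝ :=
  ∑ k ∈ s, w k * Real.cos (k * x + γ)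

theorem continuous_cosSum (s : Finset ℕ) (w : ℕ → ℝ) (γ : ℝ) : Continuous (cosSum s w γ) := by
  unfold cosSum
  fun_prop

theorem periodic_cosSum (s : Finset ℕ) (w : ℕ → ℝ) (γ : ℝ) :
    Function.Periodic (cosSum s w γ) (2 * π) := by
  intro t
  unfold cosSum
  have h : ∀ k : ℕ, Real.cos (k * (t + 2 * π) + γ) = Real.cos (k * t + γ) := fun k =>
    periodic_nat_mul Real.cos_periodic k γ t
  simp_rw [h]

theorem integral_cosSum_mul_cos {s : Finset ℕ} (hs : ∀ k ∈ s, 1 ≤ k) (w : ℕ → ℝ) (γ : ℝ)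
    (l : ℕ) (d : ℝ) :
    ∫ t in (0 : ℝ)..(2 * π), cosSum s w γ t * Real.cos (l * t + d) =
      if l ∈ s then w l * (π * Real.cos (γ - d)) else 0 := by
  unfold cosSum
  simp_rw [Finset.sum_mul, mul_assoc]
  rw [intervalIntegral.integral_finsetSum
    (fun k _ => Continuous.intervalIntegrable (by fun_prop) _ _)]
  simp_rw [intervalIntegral.integral_const_mul]
  have h : ∀ k ∈ s, w k * ∫ t in (0 : ℝ)..(2 * π), Real.cos (k * t + γ) * Real.cos (l * t + d) =
      if l = k then w k * (π * Real.cos (γ - d)) else 0 := by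
    intro k hk
    rw [integral_cos_mul_cos (by have := hs k hk; omega)]
    by_cases hkl : k = l
    · simp [hkl]
    · simp [hkl, Ne.symm hkl]
  rw [Finset.sum_congr rfl h, Finset.sum_ite_eq]

theorem fourierA_cosSum {s : Finset ℕ} (hs : ∀ k ∈ s, 1 ≤ k) (w : ℕ → ℝ) (γ : ℝ) (l : ℕ) :
    fourierA (cosSum s w γ) l = if l ∈ s then w l * Real.cos γ else 0 := by
  have h := integral_cosSum_mul_cos hs w γ l 0
  simp only [add_zero, sub_zero] at h
  unfold fourierA
  rw [h]
  split_ifs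
  · field_simp
  · simp

theorem fourierB_cosSum {s : Finset ℕ} (hs : ∀ k ∈ s, 1 ≤ k) (w : ℕ → ℝ) (γ : ℝ) (l : ℕ) :
    fourierB (cosSum s w γ) l = if l ∈ s then -(w l * Real.sin γ) else 0 := by
  have h := integral_cosSum_mul_cos hs w γ l (-(π / 2))
  have e : γ - -(π / 2) = γ + π / 2 := by ring
  simp only [← sub_eq_add_neg, Real.cos_sub_pi_div_two, e, Real.cos_add_pi_div_two] at h
  unfold fourierB
  rw [h]
  split_ifs
  · field_simp
  · simp

theorem isPsiBetaDeriv_cosSum {ψ : ℝ → ℝ} (β : ℝ) (hψ : ∀ k : ℕ, 1 ≤ k → 0 < ψ k)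
    {s : Finset ℕ} (hs : ∀ k ∈ s, 1 ≤ k) (w : ℕ → ℝ) :
    IsPsiBetaDeriv ψ β (cosSum s (fun k => ψ k * w k) 0) (cosSum s w (β * π / 2)) := by
  refine ⟨⟨periodic_cosSum _ _ _, integrable_periodMeasure_of_continuous (continuous_cosSum _ _ _)⟩,
    ⟨periodic_cosSum _ _ _, integrable_periodMeasure_of_continuous (continuous_cosSum _ _ _)⟩,
    fun k => ?_, fun k hk => ?_⟩
  · simp only [fourierA_cosSum hs, fourierB_cosSum hs, Real.cos_zero, Real.sin_zero]
    by_cases hks : k ∈ s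
    · have hk := hs k hks
      have := (hψ k hk).ne'
      simp only [if_pos hks, if_neg (show k ≠ 0 by omega)]
      field_simp
      ring
    · simp [hks]
  · simp only [fourierA_cosSum hs, fourierB_cosSum hs, Real.cos_zero, Real.sin_zero]
    by_cases hks : k ∈ s
    · have := (hψ k hk).ne'
      simp only [if_pos hks]
      field_simp
      ring
    · simp [hks]

/-- The coefficients of the Fejér kernel of order `n`, shifted by `2n`. -/
noncomputable def fejerWeight (n k : ℕ) : ℝ := 1 - |(k : ℝ) - 2 * n| / n

/-- The weights are symmetric about `2n`; pairing the frequencies `2n - j` and `2n + j` factors out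
`cos(2nx + γ)`. -/
theorem cosSum_fejerWeight {n : ℕ} (hn : 1 ≤ n) (γ x : ℝ) :
    cosSum (Finset.Ico (n + 1) (3 * n)) (fejerWeight n) γ x =
      Real.cos ((2 * n : ℕ) * x + γ) * fejerKernel n x := by
  unfold cosSum fejerKernel
  have hn0 : (n : ℝ) ≠ 0 := by positivity
  have h1 : ∑ k ∈ Finset.Ico (n + 1) (2 * n), fejerWeight n k * Real.cos (k * x + γ) =
      ∑ j ∈ Finset.Ico 1 n, (1 - (j : ℝ) / n) * Real.cos (((2 * n : ℕ) : ℝ) * x + γ - j * x) := by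
    have := Finset.sum_Ico_reflect (fun k : ℕ => fejerWeight n k * Real.cos (k * x + γ)) 1
      (m := n) (n := 2 * n) (by omega)
    have e1 : 2 * n + 1 - n = n + 1 := by omega
    have e2 : 2 * n + 1 - 1 = 2 * n := by omega
    rw [e1, e2] at this
    rw [← this]
    refine Finset.sum_congr rfl fun j hj => ?_
    rw [Finset.mem_Ico] at hj
    rw [Nat.cast_sub (by omega), fejerWeight, Nat.cast_sub (by omega)]
    push_cast
    have e3 : (2 * (n : ℝ) - j - 2 * n) = -j := by ring
    rw [e3, abs_neg, Nat.abs_cast]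
    congr 2
    ring
  have h2 : ∑ k ∈ Finset.Ico (2 * n + 1) (3 * n), fejerWeight n k * Real.cos (k * x + γ) =
      ∑ j ∈ Finset.Ico 1 n, (1 - (j : ℝ) / n) * Real.cos (((2 * n : ℕ) : ℝ) * x + γ + j * x) := by
    have := Finset.sum_Ico_add (fun k : ℕ => fejerWeight n k * Real.cos (k * x + γ)) 1 n (2 * n)
    have e1 : 1 + 2 * n = 2 * n + 1 := by omega
    have e2 : n + 2 * n = 3 * n := by omega
    rw [e1, e2] at this
    rw [← this]
    refine Finset.sum_congr rfl fun j _ => ?_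
    rw [fejerWeight]
    push_cast
    have e3 : (2 * (n : ℝ) + j - 2 * n) = j := by ring
    rw [e3, Nat.abs_cast]
    congr 2
    ring
  have h3 : fejerWeight n (2 * n) = 1 := by simp [fejerWeight]
  rw [← Finset.sum_Ico_consecutive _ (by omega : n + 1 ≤ 2 * n) (by omega : 2 * n ≤ 3 * n),
    Finset.sum_eq_sum_Ico_succ_bot (by omega : 2 * n < 3 * n), h1, h2, h3, add_left_comm,
    ← Finset.sum_add_distrib, mul_add, mul_one, one_mul, mul_left_comm, Finset.mul_sum,
    Finset.mul_sum]
  congr 1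
  refine Finset.sum_congr rfl fun j _ => ?_
  rw [Real.cos_sub, Real.cos_add (((2 * n : ℕ) : ℝ) * x + γ)]
  ring

theorem cosSum_const_mul (s : Finset ℕ) (κ : ℝ) (w : ℕ → ℝ) (γ x : ℝ) :
    cosSum s (fun k => κ * w k) γ x = κ * cosSum s w γ x := by
  unfold cosSum
  rw [Finset.mul_sum]
  exact Finset.sum_congr rfl fun k _ => mul_assoc _ _ _

theorem abs_cosSum_fejerWeight_le {n : ℕ} (hn : 1 ≤ n) (γ x : ℝ) :
    |cosSum (Finset.Ico (n + 1) (3 * n)) (fejerWeight n) γ x| ≤ fejerKernel n x := by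
  have h0 := fejerKernel_nonneg hn x
  rw [cosSum_fejerWeight hn, abs_mul, abs_of_nonneg h0]
  have := Real.abs_cos_le_one ((2 * n : ℕ) * x + γ)
  nlinarith

/-- The factor which puts the shifted Fejér kernel into the unit ball of `L_p`. -/
noncomputable def lpFactor (p : ℝ) (n : ℕ) : ℝ := (n : ℝ) ^ (1 / p - 1) / (2 * π)

theorem eLpNorm_cosSum_le_one {p : ℝ} (hp : 1 ≤ p) {n : ℕ} (hn : 1 ≤ n) (γ : ℝ) :
    eLpNorm (cosSum (Finset.Ico (n + 1) (3 * n)) (fun k => lpFactor p n * fejerWeight n k) γ)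
      (ENNReal.ofReal p) periodMeasure ≤ 1 := by
  have hp0 : 0 < p := by linarith
  have hn0 : (0 : ℝ) < n := by exact_mod_cast hn
  have hπ := Real.pi_pos
  set φ := cosSum (Finset.Ico (n + 1) (3 * n)) (fun k => lpFactor p n * fejerWeight n k) γ with hφ
  have hφc : Continuous φ := continuous_cosSum _ _ _
  have hκ : 0 ≤ lpFactor p n := by unfold lpFactor; positivity
  rw [(memLp_periodMeasure_of_continuous hφc _).eLpNorm_eq_integral_rpow_norm (by simpa using hp0)
    ENNReal.ofReal_ne_top, ENNReal.ofReal_le_one, ENNReal.toReal_ofReal hp0.le,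
    ← intervalIntegral_eq_periodMeasure]
  have h0 : 0 ≤ ∫ t in (0 : ℝ)..(2 * π), ‖φ t‖ ^ p :=
    intervalIntegral.integral_nonneg (by positivity) fun t _ => by positivity
  refine Real.rpow_le_one h0 ?_ (by positivity)
  -- Interpolation between `F ≤ n` and `∫ F = 2π`: the bound `F^p ≤ n^(p-1) F` makes the `L_p` norm
  -- of the kernel at most of order `n^(1-1/p)`, which `lpFactor` cancels.
  have hb : ∀ t, ‖φ t‖ ^ p ≤ lpFactor p n ^ p * (n : ℝ) ^ (p - 1) * fejerKernel n t := by
    intro t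
    have hF0 := fejerKernel_nonneg hn t
    have h1 : ‖φ t‖ ≤ lpFactor p n * fejerKernel n t := by
      rw [hφ, cosSum_const_mul, norm_mul, Real.norm_eq_abs, Real.norm_eq_abs, abs_of_nonneg hκ]
      gcongr
      exact abs_cosSum_fejerWeight_le hn γ t
    calc ‖φ t‖ ^ p ≤ (lpFactor p n * fejerKernel n t) ^ p := by gcongr
      _ = lpFactor p n ^ p * (fejerKernel n t ^ (p - 1) * fejerKernel n t) := by
        rw [Real.mul_rpow hκ hF0, ← Real.rpow_add_one' hF0 (by linarith), sub_add_cancel]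
      _ ≤ lpFactor p n ^ p * ((n : ℝ) ^ (p - 1) * fejerKernel n t) := by
        gcongr
        exact fejerKernel_le hn t
      _ = _ := by ring
  calc ∫ t in (0 : ℝ)..(2 * π), ‖φ t‖ ^ p
      ≤ ∫ t in (0 : ℝ)..(2 * π), lpFactor p n ^ p * (n : ℝ) ^ (p - 1) * fejerKernel n t := by
        refine intervalIntegral.integral_mono_on (by positivity)
          ((hφc.norm.rpow_const fun _ => Or.inr hp0.le).intervalIntegrable _ _)
          (((continuous_fejerKernel n).const_mul _).intervalIntegrable _ _) fun t _ => hb t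
    _ = lpFactor p n ^ p * (n : ℝ) ^ (p - 1) * (2 * π) := by
        rw [intervalIntegral.integral_const_mul, integral_fejerKernel]
    _ = 2 * π / (2 * π) ^ p := by
        unfold lpFactor
        rw [Real.div_rpow (by positivity) (by positivity), ← Real.rpow_mul hn0.le]
        have : (n : ℝ) ^ ((1 / p - 1) * p) * (n : ℝ) ^ (p - 1) = 1 := by
          rw [← Real.rpow_add hn0]
          have : (1 / p - 1) * p + (p - 1) = 0 := by field_simp; ring
          rw [this, Real.rpow_zero]
        rw [div_mul_eq_mul_div, this]
        ring
    _ ≤ 1 := by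
        rw [div_le_one (by positivity)]
        have h1 : (1 : ℝ) ≤ 2 * π := by linarith [Real.pi_gt_three]
        calc 2 * π = (2 * π) ^ (1 : ℝ) := (Real.rpow_one _).symm
          _ ≤ _ := Real.rpow_le_rpow_of_exponent_le h1 hp

theorem cosSum_mem_classC {ψ : ℝ → ℝ} (β : ℝ) {p : ℝ} (hψ : ∀ k : ℕ, 1 ≤ k → 0 < ψ k)
    (hp : 1 ≤ p) {n : ℕ} (hn : 1 ≤ n) :
    cosSum (Finset.Ico (n + 1) (3 * n)) (fun k => ψ k * (lpFactor p n * fejerWeight n k)) 0 ∈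
      classC ψ β p := by
  refine ⟨continuous_cosSum _ _ _, periodic_cosSum _ _ _, _,
    isPsiBetaDeriv_cosSum β hψ (fun k hk => ?_) _,
    memLp_periodMeasure_of_continuous (continuous_cosSum _ _ _) _, eLpNorm_cosSum_le_one hp hn _⟩
  rw [Finset.mem_Ico] at hk
  omega

theorem integral_cosSum_mul_cosSum {s : Finset ℕ} (hs : ∀ k ∈ s, 1 ≤ k) (v w : ℕ → ℝ) :
    ∫ t in (0 : ℝ)..(2 * π), cosSum s v 0 t * cosSum s w 0 t = π * ∑ k ∈ s, v k * w k := by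
  have hc := continuous_cosSum s v 0
  have h : ∀ t, cosSum s v 0 t * cosSum s w 0 t =
      ∑ k ∈ s, w k * (cosSum s v 0 t * Real.cos (k * t + 0)) := by
    intro t
    conv_lhs => rw [cosSum.eq_def s w, Finset.mul_sum]
    exact Finset.sum_congr rfl fun k _ => mul_left_comm _ _ _
  simp_rw [h]
  rw [intervalIntegral.integral_finsetSum
    (fun k _ => Continuous.intervalIntegrable (by fun_prop) _ _), Finset.mul_sum]
  refine Finset.sum_congr rfl fun k hk => ?_
  rw [intervalIntegral.integral_const_mul, integral_cosSum_mul_cos hs, if_pos hk]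
  simp
  ring

theorem integral_trigPoly_mul_cosSum {s : Finset ℕ} (w : ℕ → ℝ) {n : ℕ} (hn : 1 ≤ n)
    (hs : ∀ k ∈ s, n ≤ k) {T : ℝ → ℝ} (hT : T ∈ trigPolys n) :
    ∫ t in (0 : ℝ)..(2 * π), T t * cosSum s w 0 t = 0 := by
  obtain ⟨c, d, hcd⟩ := hT
  have hs1 : ∀ k ∈ s, 1 ≤ k := fun k hk => hn.trans (hs k hk)
  have hc := continuous_cosSum s w 0
  have hcos : ∀ k < n, ∫ t in (0 : ℝ)..(2 * π), cosSum s w 0 t * Real.cos (k * t) = 0 := by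
    intro k hk
    have := integral_cosSum_mul_cos hs1 w 0 k 0
    rw [if_neg (fun h => by have := hs k h; omega)] at this
    simpa using this
  have hsin : ∀ k < n, ∫ t in (0 : ℝ)..(2 * π), cosSum s w 0 t * Real.sin (k * t) = 0 := by
    intro k hk
    have := integral_cosSum_mul_cos hs1 w 0 k (-(π / 2))
    rw [if_neg (fun h => by have := hs k h; omega)] at this
    simpa only [← sub_eq_add_neg, Real.cos_sub_pi_div_two] using this
  have h0 : ∫ t in (0 : ℝ)..(2 * π), cosSum s w 0 t = 0 := by
    have := hcos 0 (by omega)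
    simpa using this
  have h : ∀ t, T t * cosSum s w 0 t = c 0 / 2 * cosSum s w 0 t +
      ∑ k ∈ Finset.Ico 1 n, (c k * (cosSum s w 0 t * Real.cos (k * t)) +
        d k * (cosSum s w 0 t * Real.sin (k * t))) := by
    intro t
    rw [hcd, add_mul, Finset.sum_mul]
    congr 1
    refine Finset.sum_congr rfl fun k _ => ?_
    ring
  simp_rw [h]
  rw [intervalIntegral.integral_add (Continuous.intervalIntegrable (by fun_prop) _ _)
    (Continuous.intervalIntegrable (by fun_prop) _ _), intervalIntegral.integral_finsetSum
    (fun k _ => Continuous.intervalIntegrable (by fun_prop) _ _),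
    intervalIntegral.integral_const_mul, h0, mul_zero, zero_add]
  refine Finset.sum_eq_zero fun k hk => ?_
  rw [Finset.mem_Ico] at hk
  rw [intervalIntegral.integral_add (Continuous.intervalIntegrable (by fun_prop) _ _)
    (Continuous.intervalIntegrable (by fun_prop) _ _), intervalIntegral.integral_const_mul,
    intervalIntegral.integral_const_mul, hcos k hk.2, hsin k hk.2]
  simp

theorem le_sum_fejerWeight_sq {n : ℕ} (hn : 1 ≤ n) :
    (n : ℝ) / 8 ≤ ∑ k ∈ Finset.Ico (n + 1) (3 * n), fejerWeight n k ^ 2 := by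
  have hn0 : (0 : ℝ) < n := by exact_mod_cast hn
  -- On these `⌈n/2⌉` frequencies `k ≤ 5n/2`, so each weight is at least `1/2` and the sum of
  -- squares at least `(n/2)(1/4)`.
  have hsub : Finset.Ico (2 * n) (2 * n + (n + 1) / 2) ⊆ Finset.Ico (n + 1) (3 * n) := by
    intro k hk
    rw [Finset.mem_Ico] at hk ⊢
    omega
  refine le_trans ?_ (Finset.sum_le_sum_of_subset_of_nonneg hsub fun k _ _ => sq_nonneg _)
  have h1 : ∀ k ∈ Finset.Ico (2 * n) (2 * n + (n + 1) / 2), (1 : ℝ) / 4 ≤ fejerWeight n k ^ 2 := by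
    intro k hk
    rw [Finset.mem_Ico] at hk
    have hk1 : (2 * n : ℝ) ≤ k := by exact_mod_cast hk.1
    have hk2 : (2 * k : ℝ) ≤ 5 * n := by exact_mod_cast (by omega : 2 * k ≤ 5 * n)
    have : |(k : ℝ) - 2 * n| / n ≤ 1 / 2 := by
      rw [abs_of_nonneg (by linarith), div_le_iff₀ hn0]
      linarith
    have h2 : 1 / 2 ≤ fejerWeight n k := by unfold fejerWeight; linarith
    nlinarith
  refine le_trans ?_ (Finset.card_nsmul_le_sum _ _ _ h1)
  rw [Nat.card_Ico, nsmul_eq_mul, Nat.add_sub_cancel_left]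
  have : (n : ℝ) ≤ 2 * ((n + 1) / 2 : ℕ) := by exact_mod_cast (by omega : n ≤ 2 * ((n + 1) / 2))
  linarith

/-- Duality: the modulated kernel `g` is orthogonal to `T` and has `L_1` norm at most `2π`, so a
uniformly small `f - T` would force `∫ f g` to be small, while this integral is a sum of positive
terms of known size. -/
theorem exists_le_abs_sub {ψ : ℝ → ℝ} {p a b C : ℝ} (ha : 1 < a)
    (h : PowerRegular (fun k : ℕ => ψ k) a b C) {n : ℕ} (hn : 1 ≤ n)
    {T : ℝ → ℝ} (hT : T ∈ trigPolys n) :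
    ∃ x, 1 / (64 * π * (C * 3 ^ a)) * (ψ n * (n : ℝ) ^ (1 / p)) ≤
      |cosSum (Finset.Ico (n + 1) (3 * n)) (fun k => ψ k * (lpFactor p n * fejerWeight n k)) 0 x -
        T x| := by
  have hπ := Real.pi_pos
  have hC := h.one_le
  have hn0 : (0 : ℝ) < n := by exact_mod_cast hn
  have hψn : 0 < ψ n := h.pos n hn
  have hκ : 0 < lpFactor p n := by unfold lpFactor; positivity
  set s := Finset.Ico (n + 1) (3 * n) with hs
  set f := cosSum s (fun k => ψ k * (lpFactor p n * fejerWeight n k)) 0 with hf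
  set g := cosSum s (fejerWeight n) 0 with hg
  set c := 1 / (64 * π * (C * 3 ^ a)) * (ψ n * (n : ℝ) ^ (1 / p)) with hc
  have hc0 : 0 < c := by positivity
  by_contra! hlt
  have hfc : Continuous f := continuous_cosSum _ _ _
  have hgc : Continuous g := continuous_cosSum _ _ _
  have hTc : Continuous T := by
    obtain ⟨c', d', hcd⟩ := hT
    rw [funext hcd]
    fun_prop
  have hFc := continuous_fejerKernel n
  have hs1 : ∀ k ∈ s, n ≤ k := fun k hk => by
    rw [hs, Finset.mem_Ico] at hk
    omega
  have hint : ∫ t in (0 : ℝ)..(2 * π), (f t - T t) * g t =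
      π * ∑ k ∈ s, ψ k * (lpFactor p n * fejerWeight n k) * fejerWeight n k := by
    simp_rw [sub_mul]
    rw [intervalIntegral.integral_sub (Continuous.intervalIntegrable (by fun_prop) _ _)
      (Continuous.intervalIntegrable (by fun_prop) _ _),
      integral_trigPoly_mul_cosSum _ hn hs1 hT, sub_zero,
      integral_cosSum_mul_cosSum (fun k hk => hn.trans (hs1 k hk))]
  have hupper : ∫ t in (0 : ℝ)..(2 * π), (f t - T t) * g t ≤ c * (2 * π) := by
    have e : c * (2 * π) = ∫ t in (0 : ℝ)..(2 * π), c * fejerKernel n t := by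
      rw [intervalIntegral.integral_const_mul, integral_fejerKernel]
    rw [e]
    refine intervalIntegral.integral_mono_on (by positivity)
      (((hfc.sub hTc).mul hgc).intervalIntegrable _ _)
      ((continuous_const.mul hFc).intervalIntegrable _ _) fun t _ => ?_
    refine (le_abs_self _).trans ?_
    rw [abs_mul]
    exact mul_le_mul (hlt t).le (abs_cosSum_fejerWeight_le hn 0 t) (abs_nonneg _) hc0.le
  have hlower : ψ n / (C * 3 ^ a) * lpFactor p n * (n / 8) ≤
      ∑ k ∈ s, ψ k * (lpFactor p n * fejerWeight n k) * fejerWeight n k := by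
    calc ψ n / (C * 3 ^ a) * lpFactor p n * (n / 8)
        ≤ ψ n / (C * 3 ^ a) * lpFactor p n * ∑ k ∈ s, fejerWeight n k ^ 2 := by
          gcongr
          exact le_sum_fejerWeight_sq hn
      _ = ∑ k ∈ s, ψ n / (C * 3 ^ a) * (lpFactor p n * fejerWeight n k ^ 2) := by
          rw [Finset.mul_sum]
          exact Finset.sum_congr rfl fun k _ => mul_assoc _ _ _
      _ ≤ ∑ k ∈ s, ψ k * (lpFactor p n * fejerWeight n k ^ 2) := by
          refine Finset.sum_le_sum fun k hk => ?_
          gcongr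
          rw [div_le_iff₀ (by positivity), mul_comm]
          refine h.doubling (by linarith) hn (hs1 k hk) ?_
          rw [hs, Finset.mem_Ico] at hk
          exact_mod_cast hk.2.le
      _ = _ := Finset.sum_congr rfl fun k _ => by ring
  -- The constant `64π` in `c` makes the lower bound exactly twice the upper one, hence a strict
  -- contradiction.
  have hval : π * (ψ n / (C * 3 ^ a) * lpFactor p n * (n / 8)) = 2 * (c * (2 * π)) := by
    have e : (n : ℝ) ^ (1 / p) = (n : ℝ) ^ (1 / p - 1) * n := by
      rw [← Real.rpow_add_one hn0.ne', sub_add_cancel]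
    rw [hc, lpFactor, e]
    field_simp
    norm_num
  have := mul_le_mul_of_nonneg_left hlower hπ.le
  have h2 : 0 < c * (2 * π) := by positivity
  linarith

/-! ### Assembling the order equalities. -/

theorem ofReal_le_normC {f : ℝ → ℝ} {c x : ℝ} (h : c ≤ |f x|) : ENNReal.ofReal c ≤ normC f := by
  refine le_trans ?_ (le_iSup (fun x => ‖f x‖ₑ) x)
  rw [← ofReal_norm, Real.norm_eq_abs]
  exact ENNReal.ofReal_le_ofReal h

theorem normC_le_ofReal {f : ℝ → ℝ} {c : ℝ} (h : ∀ x, |f x| ≤ c) : normC f ≤ ENNReal.ofReal c := by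
  refine iSup_le fun x => ?_
  rw [← ofReal_norm, Real.norm_eq_abs]
  exact ENNReal.ofReal_le_ofReal (h x)

theorem fejerSum_mem_trigPolys (n : ℕ) (f : ℝ → ℝ) : fejerSum n f ∈ trigPolys n := by
  refine ⟨fun k => if k = 0 then fourierA f 0 else (1 - (k : ℝ) / n) * fourierA f k,
    fun k => (1 - (k : ℝ) / n) * fourierB f k, fun x => ?_⟩
  unfold fejerSum
  beta_reduce
  rw [if_pos rfl]
  congr 1
  refine Finset.sum_congr rfl fun k hk => ?_
  rw [Finset.mem_Ico] at hk
  rw [if_neg (by omega)]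
  ring

theorem bestApprox_le_fejerDeviation (ψ : ℝ → ℝ) (β p : ℝ) (n : ℕ) :
    bestApprox ψ β p n ≤ fejerDeviation ψ β p n := by
  refine iSup₂_mono fun f _ => ?_
  exact iInf₂_le (fejerSum n f) (fejerSum_mem_trigPolys n f)

theorem BigO.trans {A B D : ℕ → ℝ≥0∞} (h₁ : BigO A B) (h₂ : BigO B D) : BigO A D := by
  obtain ⟨K₁, hK₁, h₁⟩ := h₁
  obtain ⟨K₂, hK₂, h₂⟩ := h₂
  refine ⟨K₁ * K₂, by positivity, fun n hn => ?_⟩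
  rw [ENNReal.ofReal_mul hK₁.le, mul_assoc]
  exact (h₁ n hn).trans (by gcongr; exact h₂ n hn)

theorem bigO_of_le {A B : ℕ → ℝ≥0∞} (h : ∀ n, A n ≤ B n) : BigO A B :=
  ⟨1, one_pos, fun n _ => by simpa using h n⟩

/-- The orders of the best approximations and of the deviations of the Fejér sums. -/
theorem orderEq_bestApprox_fejerDeviation {ψ : ℝ → ℝ} (β : ℝ) {p : ℝ} (hp : 1 ≤ p) (hψ : ψ ∈ setM)
    (hg : gFun ψ (1 / p) ∈ setMC) (hGA : IsGA (fun k : ℕ => gFun ψ (1 + 1 / p) k)) :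
    OrderEq (bestApprox ψ β p) (fejerDeviation ψ β p) ∧
      OrderEq (fejerDeviation ψ β p) (fun n => ENNReal.ofReal (ψ n * (n : ℝ) ^ (1 / p))) := by
  obtain ⟨a, b, C, ha1, ha, hb, hb1, h⟩ := exists_powerRegular hp hψ hg hGA
  have hC := h.one_le
  have hπ := Real.pi_pos
  have hEF : BigO (bestApprox ψ β p) (fejerDeviation ψ β p) :=
    bigO_of_le (bestApprox_le_fejerDeviation ψ β p)
  have hFG : BigO (fejerDeviation ψ β p) (fun n => ENNReal.ofReal (ψ n * (n : ℝ) ^ (1 / p))) := by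
    obtain ⟨K, hK, hKn⟩ := exists_abs_sub_fejerSum_le (β := β) hp ha1 ha hb hb1 h
    -- `K` is only known to be nonnegative, whereas `BigO` asks for a positive constant.
    refine ⟨K + 1, by linarith, fun n hn => ?_⟩
    rw [← ENNReal.ofReal_mul (by linarith)]
    have hun : 0 < ψ n := h.pos n hn
    refine iSup₂_le fun f hf => normC_le_ofReal fun x => (hKn n hn f hf x).trans ?_
    gcongr
    linarith
  have hGE : BigO (fun n => ENNReal.ofReal (ψ n * (n : ℝ) ^ (1 / p))) (bestApprox ψ β p) := by
    refine ⟨64 * π * (C * 3 ^ a), by positivity, fun n hn => ?_⟩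
    have hle : ENNReal.ofReal (1 / (64 * π * (C * 3 ^ a)) * (ψ n * (n : ℝ) ^ (1 / p))) ≤
        bestApprox ψ β p n := by
      refine le_trans ?_ (le_iSup₂ (f := fun f (_ : f ∈ classC ψ β p) =>
        ⨅ t ∈ trigPolys n, normC (fun x => f x - t x)) _ (cosSum_mem_classC β h.pos hp hn))
      refine le_iInf₂ fun T hT => ?_
      obtain ⟨x, hx⟩ := exists_le_abs_sub (p := p) ha1 h hn hT
      exact ofReal_le_normC hx
    calc ENNReal.ofReal (ψ n * (n : ℝ) ^ (1 / p))
        = ENNReal.ofReal (64 * π * (C * 3 ^ a)) *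
          ENNReal.ofReal (1 / (64 * π * (C * 3 ^ a)) * (ψ n * (n : ℝ) ^ (1 / p))) := by
          rw [← ENNReal.ofReal_mul (by positivity), ← mul_assoc, mul_one_div_cancel (by positivity),
            one_mul]
      _ ≤ _ := by gcongr
  exact ⟨⟨hEF, hFG.trans hGE⟩, hFG, hGE.trans hEF⟩

end PsiBeta

theorem proposition2 (ψ : ℝ → ℝ) (β p : ℝ) (hp : 1 ≤ p)
    (hψ : ψ ∈ PsiBeta.setM)
    (hg : PsiBeta.gFun ψ (1 / p) ∈ PsiBeta.setMC)
    (hGM : PsiBeta.IsGM (fun k : ℕ => PsiBeta.gFun ψ (1 + 1 / p) k))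
    (hGA : PsiBeta.IsGA (fun k : ℕ => PsiBeta.gFun ψ (1 + 1 / p) k)) :
    (∀ q : ℝ, 1 < p → 1 / p + 1 / q = 1 →
      (Summable fun k : ℕ => ψ ((k : ℝ) + 1) ^ q * ((k : ℝ) + 1) ^ (q - 2)) →
      q / 2 < (⨅ t : Set.Ici (1 : ℝ), PsiBeta.alpha (PsiBeta.gFun ψ (1 / p)) t) →
      PsiBeta.OrderEq (PsiBeta.bestApprox ψ β p) (PsiBeta.fejerDeviation ψ β p) ∧
      PsiBeta.OrderEq (PsiBeta.fejerDeviation ψ β p)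
        (fun n => ENNReal.ofReal (ψ n * (n : ℝ) ^ (1 / p)))) ∧
    (p = 1 →
      (Summable fun k : ℕ => ψ ((k : ℝ) + 1)) →
      1 < (⨅ t : Set.Ici (1 : ℝ), PsiBeta.alpha (PsiBeta.gFun ψ 1) t) →
      PsiBeta.OrderEq (PsiBeta.bestApprox ψ β 1) (PsiBeta.fejerDeviation ψ β 1) ∧
      PsiBeta.OrderEq (PsiBeta.fejerDeviation ψ β 1)
        (fun n => ENNReal.ofReal (ψ n * n))) := by
  refine ⟨fun q _ _ _ _ => PsiBeta.orderEq_bestApprox_fejerDeviation β hp hψ hg hGA, ?_⟩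
  rintro rfl _ _
  have h := PsiBeta.orderEq_bestApprox_fejerDeviation β hp hψ hg hGA
  simp only [div_one, Real.rpow_one] at h
  exact h
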